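/- **Setting.** Let $q\in\mathbb C^*$ be not a root of unity and let $(x;q)_n=\prod_{j=0}^{n-1}(1-xq^j)$, $(x_1,\dots,x_r;q)_n=\prod_j (x_j;q)_n$. Let $\Gamma$ be a distance-regular graph with vertex set $X$, diameter $D\ge 3$, distance function $\partial$, intersection numbers $a_i,b_i,c_i$ and adjacency matrix $A$, and let $\theta_0,\dots,\theta_D$ be an ordering of the distinct eigenvalues of $A$ such that the corresponding primitive idempotents $E_0,\dots,E_D$ are $Q$-polynomial (for $0\le i\le D$, $E_i$ is a polynomial of degree $i$ in $E_1$ for the entrywise product) and such that $\theta_D$ is the least eigenvalue. Let $C$ be a Delsarte clique of $\Gamma$ (a nonempty clique with $|C|=1-b_0/\theta_{\min}$, where $\theta_{\min}$ is the least eigenvalue) and let $x\in C$. Let $A^*=\mathrm{diag}\big(|X|(E_1)_{xy}\big)_{y\in X}$, let $\theta^*_i$ be its diagonal entries at the vertices $y$ with $\partial(x,y)=i$, and let $M\hat x$ be the span of the vectors $A^n\hat x$ $(n\ge0)$. Let $(\{\theta_i\}_{i=0}^D,\{\theta_i^*\}_{i=0}^D,\{\varphi_i\}_{i=1}^D,\{\phi_i\}_{i=1}^D)$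 be the parameter array of the Leonard system given by $A,A^*$ on $M\hat x$: there is a basis $u_0,\dots,u_D$ of $M\hat x$ with $Au_i=\theta_iu_i+u_{i+1}$ and $A^*u_i=\theta^*_iu_i+\varphi_iu_{i-1}$ $(u_{-1}=u_{D+1}=0)$, and the same holds with $\{\theta_{D-i}\},\{\phi_i\}$ in place of $\{\theta_i\},\{\varphi_i\}$. Assume that the array has $q$-Racah type: there are nonzero scalars $h,h^*,s,s^*,r_1,r_2\in\mathbb C$ with $r_1r_2=ss^*q^{D+1}$ and $$\theta_i=\theta_0+h(1-q^i)(1-sq^{i+1})q^{-i},\qquad \theta^*_i=\theta^*_0+h^*(1-q^i)(1-s^*q^{i+1})q^{-i}\qquad(0\le i\le D),$$ $$\varphi_i=hh^*q^{1-2i}(1-q^i)(1-q^{i-D-1})(1-r_1q^i)(1-r_2q^i)\qquad(1\le i\le D),$$ $$\phi_i=hh^*q^{1-2i}(1-q^i)(1-q^{i-D-1})(r_1-s^*q^i)(r_2-s^*q^i)/s^*\qquad(1\le i\le D),$$ where none of $q^i,r_1q^i,r_2q^i,s^*q^i/r_1,s^*q^i/r_2$ $(1\le i\le D)$ and none of $sq^i,s^*q^i$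 $(2\le i\le 2D)$ equals $1$. Fix square roots of $q,s,s^*,r_1,r_2$ with $r_1^{1/2}r_2^{1/2}=s^{1/2}s^{*1/2}q^{(D+1)/2}$, and put $$a=\Big(\frac{r_1r_2}{s^*q^D}\Big)^{1/2},\quad b=\Big(\frac{s^*}{r_1r_2q^D}\Big)^{1/2},\quad c=\Big(\frac{r_2s^*q^{D+2}}{r_1}\Big)^{1/2},\quad d=\Big(\frac{r_1s^*q^{D+2}}{r_2}\Big)^{1/2},$$ where these square roots are formed from the fixed ones. **Askey–Wilson polynomials.** In $\mathbb C[y,y^{-1}]$ let $$p_i[y;a,b,c,d\mid q]=\sum_{j=0}^{i}\frac{(q^{-i},abcdq^{i-1},ay,ay^{-1};q)_j}{(ab,ac,ad,q;q)_j}q^j,\qquad P_i[y;a,b,c,d\mid q]=\frac{(ab,ac,ad;q)_i}{a^i(abcdq^{i-1};q)_i}\,p_i[y;a,b,c,d\mid q],$$ and write $p_i,P_i$ for these and $p_i^\perp,P_i^\perp$ for the same polynomials with $(a,b,c,d)$ replaced by $(aq,bq,c,d)$. **The Laurent polynomials $\varepsilon_i^\pm$.** For $1\le i\le D-1$ let $$\xi_i=q^{1-i}(1-q^{i-D})(1-s^*q^{i+1}),\qquad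 \epsilon_i=\frac{(1-q^i)(1-s^*q^{D+i+1})}{q^D(1-q^{i-D})(1-s^*q^{i+1})}.$$ For $0\le i\le D-1$ let $\hat C_i^-$ and $\hat C_i^+$ be the characteristic vectors of $\{y:\partial(y,C)=i,\ \partial(x,y)=i\}$ and $\{y:\partial(y,C)=i,\ \partial(x,y)=i+1\}$, and let $v_i^\perp=\xi_{i+1}\hat C_i^++\xi_{i+1}\epsilon_{i+1}\hat C_{i+1}^-$ for $0\le i\le D-2$. Let $b_i^\perp$ and $c_i^\perp$ be the $(i,i+1)$ and $(i,i-1)$ entries of the tridiagonal matrix that represents $A$ with respect to the orthogonal basis $v_0^\perp,\dots,v_{D-2}^\perp$ of its span. Let $k_i=b_0\cdots b_{i-1}/(c_1\cdots c_i)$ for $0\le i\le D$ and $k_i^\perp=b_0^\perp\cdots b_{i-1}^\perp/(c_1^\perp\cdots c_i^\perp)$ for $0\le i\le D-2$, and $$g[y]=b\,\frac{(1-s^*q^2)(1-s^*q^3)}{(1-s^*q/r_1)(1-s^*q/r_2)}\big(y-a-b+q^{-D}y^{-1}\big).$$ For $1\le i\le D-1$ define $$\varepsilon^+_{i-1}=\frac{\epsilon_i}{\epsilon_i-1}k_ip_i+\frac{k^\perp_{i-1}p^\perp_{i-1}g}{\xi_i(1-\epsilon_i)},\qquad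 \varepsilon^-_i=\frac{1}{1-\epsilon_i}k_ip_i+\frac{k^\perp_{i-1}p^\perp_{i-1}g}{\xi_i(\epsilon_i-1)},$$ and $\varepsilon_0^-=1$, $\varepsilon_{D-1}^+=k_Dp_D$. **Proposition.** For $1\le i\le D-1$, $$\varepsilon^+_{i-1}=\frac{ab(1-q^i)(1-cdq^{i-1})}{(ab-1)(1-abcdq^{2i-1})}\,\frac{(abcd;q)_{2i}}{a^i(q,bc,bd,cd;q)_i}\Big(P_i-y(1-ay^{-1})(1-by^{-1})P^\perp_{i-1}\Big),$$ $$\varepsilon^-_i=\frac{(1-abq^i)(1-abcdq^{i-1})}{(1-ab)(1-abcdq^{2i-1})}\,\frac{(abcd;q)_{2i}}{a^i(q,bc,bd,cd;q)_i}\Big(P_i-\frac{ab(1-q^i)(1-cdq^{i-1})}{(1-abq^i)(1-abcdq^{i-1})}\,y(1-ay^{-1})(1-by^{-1})P^\perp_{i-1}\Big).$$ Moreover, $$\varepsilon_0^-=1,\qquad \varepsilon^+_{D-1}=\frac{(abcd;q)_{2D-1}}{a^D(q,bc,bd;q)_D\,(cd;q)_{D-1}}\,P_D.$$ -/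

import Mathlib

open Matrix
open scoped LaurentPolynomial

namespace NonsymRacah

noncomputable section

/-! ### Distance-regular graphs -/

section Graph

variable {X : Type*} [Fintype X] [DecidableEq X]

/-- The `i`-th distance matrix `A_i`; the adjacency matrix is `distMatrix G 1`. -/
def distMatrix (G : SimpleGraph X) (i : ℕ) : Matrix X X ℂ :=
  Matrix.of fun y z => if G.dist y z = i then 1 else 0

/-- The characteristic vector of a set of vertices. -/
def charVec (S : Set X) : X → ℂ := S.indicator 1

/-- `G` is distance-regular with intersection numbers `a i`, `b i`, `c i`: it is connected and,
for vertices `x, y` at distance `i`, the neighbours of `y` at distance `i - 1`, `i`, `i + 1` from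
`x` are `c i`, `a i`, `b i` in number. -/
structure IsDistanceRegular (G : SimpleGraph X) (a b c : ℕ → ℕ) : Prop where
  connected : G.Connected
  card_closer : ∀ x y, {z | G.Adj y z ∧ G.dist x z + 1 = G.dist x y}.ncard = c (G.dist x y)
  card_same : ∀ x y, {z | G.Adj y z ∧ G.dist x z = G.dist x y}.ncard = a (G.dist x y)
  card_farther : ∀ x y, {z | G.Adj y z ∧ G.dist x z = G.dist x y + 1}.ncard = b (G.dist x y)

/-- `t` is an eigenvalue of the adjacency matrix of `G`. -/
def IsGraphEigenvalue (G : SimpleGraph X) (t : ℂ) : Prop :=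
  ∃ v : X → ℂ, v ≠ 0 ∧ distMatrix G 1 *ᵥ v = t • v

/-- `θ 0, …, θ D` is an ordering of the distinct eigenvalues of the adjacency matrix, and `E i`
is the orthogonal projection onto the eigenspace of `θ i` (the `i`-th primitive idempotent). -/
structure IsEigenOrdering (G : SimpleGraph X) (D : ℕ) (θ : ℕ → ℝ) (E : ℕ → Matrix X X ℂ) :
    Prop where
  distinct : ∀ i ≤ D, ∀ j ≤ D, θ i = θ j → i = j
  eigenvalue_iff : ∀ t : ℂ, IsGraphEigenvalue G t ↔ ∃ i ≤ D, t = (θ i : ℂ)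
  hermitian : ∀ i ≤ D, (E i).IsHermitian
  idempotent : ∀ i ≤ D, E i * E i = E i
  range_iff : ∀ i ≤ D, ∀ v : X → ℂ, E i *ᵥ v = v ↔ distMatrix G 1 *ᵥ v = (θ i : ℂ) • v

/-- The ordering `E 0, …, E D` is `Q`-polynomial: for `i ≤ D`, `E i` is a polynomial of degree
exactly `i` in `E 1` with respect to the entrywise product. -/
def IsQPolynomial (D : ℕ) (E : ℕ → Matrix X X ℂ) : Prop :=
  ∀ i ≤ D, ∃ f : Polynomial ℂ, f.degree = i ∧ ∀ y z, E i y z = f.eval (E 1 y z)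

/-- The dual adjacency matrix `A*` with respect to the vertex `x`: the diagonal matrix with
`(y, y)`-entry `|X| (E_1)_{xy}`. -/
def dualAdj (E : ℕ → Matrix X X ℂ) (x : X) : Matrix X X ℂ :=
  Matrix.diagonal fun y => (Fintype.card X : ℂ) * E 1 x y

/-- `θs i` is the eigenvalue of `A*` on the `i`-th subconstituent of `x` (the dual eigenvalues). -/
def IsDualEigenvalues (G : SimpleGraph X) (E : ℕ → Matrix X X ℂ) (x : X) (θs : ℕ → ℂ) : Prop :=
  ∀ y, dualAdj E x y y = θs (G.dist x y)

/-- `C` is a Delsarte clique: a nonempty clique with `|C| = 1 - k / θ_min`, where `k` is the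
valency and `θ_min` is the least eigenvalue of the graph. -/
def IsDelsarteClique (G : SimpleGraph X) (k : ℕ) (C : Finset X) : Prop :=
  C.Nonempty ∧ G.IsClique (C : Set X) ∧
    ∃ τ : ℝ, IsLeast {t : ℝ | IsGraphEigenvalue G (t : ℂ)} τ ∧ (C.card : ℝ) = 1 - k / τ

/-- The distance from a vertex to a (nonempty) set of vertices. -/
def distToSet (G : SimpleGraph X) (y : X) (C : Finset X) : ℕ :=
  sInf (G.dist y '' (C : Set X))

/-- `C_i⁻ = Γ_i(x) ∩ C_i`. -/
def cellMinus (G : SimpleGraph X) (x : X) (C : Finset X) (i : ℕ) : Set X :=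
  {y | G.dist x y = i ∧ distToSet G y C = i}

/-- `C_i⁺ = Γ_{i+1}(x) ∩ C_i`. -/
def cellPlus (G : SimpleGraph X) (x : X) (C : Finset X) (i : ℕ) : Set X :=
  {y | G.dist x y = i + 1 ∧ distToSet G y C = i}

/-- `M x̂`, where `M` is the algebra generated by the adjacency matrix `A`. -/
def primaryModule (G : SimpleGraph X) (x : X) : Submodule ℂ (X → ℂ) :=
  Submodule.span ℂ (Set.range fun n : ℕ => (distMatrix G 1 ^ n) *ᵥ charVec {x})

/-! ### Parameter arrays -/

/-- There is a basis `u 0, …, u d` of the space `V` with respect to which `A` is represented by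
the lower bidiagonal matrix with diagonal `θ 0, …, θ d` and subdiagonal entries `1`, and `As` by
the upper bidiagonal matrix with diagonal `θs 0, …, θs d` and superdiagonal `φ 1, …, φ d`.
For a Leonard system, this says that `φ` is its first split sequence. -/
def IsSplitSequence (A As : Matrix X X ℂ) (V : Submodule ℂ (X → ℂ)) (d : ℕ)
    (θ θs φ : ℕ → ℂ) : Prop :=
  ∃ u : ℕ → X → ℂ,
    LinearIndependent ℂ (fun i : Fin (d + 1) => u i) ∧
    Submodule.span ℂ (Set.range fun i : Fin (d + 1) => u i) = V ∧
    (∀ i < d, A *ᵥ u i = θ i • u i + u (i + 1)) ∧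
    A *ᵥ u d = θ d • u d ∧
    As *ᵥ u 0 = θs 0 • u 0 ∧
    ∀ i < d, As *ᵥ u (i + 1) = θs (i + 1) • u (i + 1) + φ (i + 1) • u i

/-- `(θ, θs, φ, ϕ)` is the parameter array of the Leonard system on `V` given by `A`, `As` and
the indicated orderings of their eigenvalues. The second split sequence `ϕ` is the first
split sequence after inverting the ordering of the eigenvalues of `A`. -/
def IsParameterArray (A As : Matrix X X ℂ) (V : Submodule ℂ (X → ℂ)) (d : ℕ)
    (θ θs φ ϕ : ℕ → ℂ) : Prop :=
  IsSplitSequence A As V d θ θs φ ∧ IsSplitSequence A As V d (fun i => θ (d - i)) θs ϕ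

end Graph

/-- The parameter array `(θ, θs, φ, ϕ)` of diameter `d` has `q`-Racah type, with associated
scalars `h, hs, s, ss, r₁, r₂` (`hs`, `ss` stand for `h*`, `s*`). -/
structure IsQRacah (d : ℕ) (q h hs s ss r₁ r₂ : ℂ) (θ θs φ ϕ : ℕ → ℂ) : Prop where
  h_ne : h ≠ 0
  hs_ne : hs ≠ 0
  s_ne : s ≠ 0
  ss_ne : ss ≠ 0
  r₁_ne : r₁ ≠ 0
  r₂_ne : r₂ ≠ 0
  r_mul : r₁ * r₂ = s * ss * q ^ (d + 1)
  nondeg_r : ∀ i, 1 ≤ i → i ≤ d → q ^ i ≠ 1 ∧ r₁ * q ^ i ≠ 1 ∧ r₂ * q ^ i ≠ 1 ∧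
    ss * q ^ i / r₁ ≠ 1 ∧ ss * q ^ i / r₂ ≠ 1
  nondeg_s : ∀ i, 2 ≤ i → i ≤ 2 * d → s * q ^ i ≠ 1 ∧ ss * q ^ i ≠ 1
  theta : ∀ i ≤ d, θ i = θ 0 + h * (1 - q ^ i) * (1 - s * q ^ (i + 1)) / q ^ i
  thetas : ∀ i ≤ d, θs i = θs 0 + hs * (1 - q ^ i) * (1 - ss * q ^ (i + 1)) / q ^ i
  phi_one : ∀ i, 1 ≤ i → i ≤ d → φ i =
    h * hs * q ^ (1 - 2 * (i : ℤ)) * (1 - q ^ i) * (1 - q ^ ((i : ℤ) - d - 1)) *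
      (1 - r₁ * q ^ i) * (1 - r₂ * q ^ i)
  phi_two : ∀ i, 1 ≤ i → i ≤ d → ϕ i =
    h * hs * q ^ (1 - 2 * (i : ℤ)) * (1 - q ^ i) * (1 - q ^ ((i : ℤ) - d - 1)) *
      (r₁ - ss * q ^ i) * (r₂ - ss * q ^ i) / ss

/-! ### The standard basis of `M x̂^⊥` and the scalars `k_i`, `k_i^⊥` -/

/-- `ξ_i = q^{1-i} (1 - q^{i-D}) (1 - s* q^{i+1})`. -/
def xi (D : ℕ) (q ss : ℂ) (i : ℕ) : ℂ :=
  q ^ (1 - (i : ℤ)) * (1 - q ^ ((i : ℤ) - D)) * (1 - ss * q ^ (i + 1))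

/-- `ϵ_i = (1 - q^i) (1 - s* q^{D+i+1}) / (q^D (1 - q^{i-D}) (1 - s* q^{i+1}))`. -/
def eps (D : ℕ) (q ss : ℂ) (i : ℕ) : ℂ :=
  (1 - q ^ i) * (1 - ss * q ^ (D + i + 1)) /
    (q ^ D * (1 - q ^ ((i : ℤ) - D)) * (1 - ss * q ^ (i + 1)))

section Perp

variable {X : Type*} [Fintype X]

/-- `v_i^⊥ = ξ_{i+1} Ĉ_i⁺ + ξ_{i+1} ϵ_{i+1} Ĉ_{i+1}⁻`. -/
def vPerp (G : SimpleGraph X) (x : X) (C : Finset X) (D : ℕ) (q ss : ℂ) (i : ℕ) : X → ℂ :=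
  xi D q ss (i + 1) • charVec (cellPlus G x C i) +
    (xi D q ss (i + 1) * eps D q ss (i + 1)) • charVec (cellMinus G x C (i + 1))

/-- The coefficient of the orthogonal projection of `w` to the line spanned by `v`; when `v`
belongs to a family of nonzero pairwise orthogonal vectors with `w` in their span, this is the
coordinate of `w` along `v`, see `coordAlong_sum`. -/
def coordAlong (v w : X → ℂ) : ℂ := (star v ⬝ᵥ w) / (star v ⬝ᵥ v)

open scoped ComplexOrder in
theorem coordAlong_sum (S : Finset ℕ) (v : ℕ → X → ℂ) (α : ℕ → ℂ)
    (h : ∀ i ∈ S, ∀ j ∈ S, i ≠ j → star (v i) ⬝ᵥ v j = 0) (i : ℕ) (hi : i ∈ S) (h0 : v i ≠ 0) :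
    coordAlong (v i) (∑ j ∈ S, α j • v j) = α i := by
  have h1 : star (v i) ⬝ᵥ v i ≠ 0 := by
    intro h2
    exact h0 (dotProduct_star_self_eq_zero.1 h2)
  unfold coordAlong
  rw [dotProduct_sum, Finset.sum_eq_single i, dotProduct_smul, smul_eq_mul, mul_div_assoc,
    div_self h1, mul_one]
  · intro j hj hji
    rw [dotProduct_smul, h i hi j hj (Ne.symm hji), smul_zero]
  · exact fun h2 => absurd hi h2

/-- The vectors `v_i^⊥` are pairwise orthogonal, their supports being disjoint. -/
theorem vPerp_orthogonal (G : SimpleGraph X) (x : X) (C : Finset X) (D : ℕ) (q ss : ℂ)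
    {i j : ℕ} (hij : i ≠ j) :
    star (vPerp G x C D q ss i) ⬝ᵥ vPerp G x C D q ss j = 0 := by
  have h : ∀ i y, G.dist x y ≠ i + 1 → vPerp G x C D q ss i y = 0 := by
    intro i y hy
    have h1 : y ∉ cellPlus G x C i := fun h => hy h.1
    have h2 : y ∉ cellMinus G x C (i + 1) := fun h => hy h.1
    simp [vPerp, charVec, h1, h2]
  refine Finset.sum_eq_zero fun y _ => ?_
  by_cases hy : G.dist x y = i + 1
  · rw [h j y (by omega), mul_zero]
  · rw [Pi.star_apply, h i y hy, star_zero, zero_mul]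

/-- The `(i, j)`-entry of the matrix representing the adjacency matrix with respect to the basis
`v_0^⊥, …, v_{D-2}^⊥`. This matrix is tridiagonal; its `(i, i + 1)`-entry is the intersection
number `b_i^⊥` and its `(i, i - 1)`-entry is `c_i^⊥`. -/
def perpEntry (G : SimpleGraph X) (x : X) (C : Finset X) (D : ℕ) (q ss : ℂ) (i j : ℕ) : ℂ :=
  coordAlong (vPerp G x C D q ss i) (distMatrix G 1 *ᵥ vPerp G x C D q ss j)

/-- `k_i^⊥ = (b_0^⊥ ⋯ b_{i-1}^⊥) / (c_1^⊥ ⋯ c_i^⊥)`. -/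
def kPerp (G : SimpleGraph X) (x : X) (C : Finset X) (D : ℕ) (q ss : ℂ) (i : ℕ) : ℂ :=
  (∏ j ∈ Finset.range i, perpEntry G x C D q ss j (j + 1)) /
    ∏ j ∈ Finset.range i, perpEntry G x C D q ss (j + 1) j

end Perp

/-- `k_i = (b_0 ⋯ b_{i-1}) / (c_1 ⋯ c_i)`. -/
def kNum (b c : ℕ → ℕ) (i : ℕ) : ℂ :=
  (∏ j ∈ Finset.range i, (b j : ℂ)) / ∏ j ∈ Finset.range i, (c (j + 1) : ℂ)

/-! ### Askey-Wilson polynomials and the Laurent polynomials `ε_i^±` -/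

/-- `(x; q)_n = (1 - x) (1 - x q) ⋯ (1 - x q^{n-1})`. -/
def qPoch {R : Type*} [CommRing R] (x q : R) (n : ℕ) : R :=
  ∏ j ∈ Finset.range n, (1 - x * q ^ j)

open LaurentPolynomial in
/-- The Askey-Wilson polynomial `p_i(y + y⁻¹; a, b, c, d | q)`, the terminating series
`₄φ₃(q^{-i}, abcd q^{i-1}, a y, a y⁻¹; ab, ac, ad | q, q)`, as a Laurent polynomial in `y = T 1`. -/
def askeyWilson (q a b c d : ℂ) (i : ℕ) : ℂ[T;T⁻¹] :=
  ∑ j ∈ Finset.range (i + 1),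
    C (qPoch (q ^ (-(i : ℤ))) q j * qPoch (a * b * c * d * q ^ ((i : ℤ) - 1)) q j /
        (qPoch (a * b) q j * qPoch (a * c) q j * qPoch (a * d) q j * qPoch q q j) * q ^ j) *
      (qPoch (C a * T 1) (C q) j * qPoch (C a * T (-1)) (C q) j)

open LaurentPolynomial in
/-- The monic Askey-Wilson polynomial `P_i[y; a, b, c, d | q]`. -/
def monicAW (q a b c d : ℂ) (i : ℕ) : ℂ[T;T⁻¹] :=
  C (qPoch (a * b) q i * qPoch (a * c) q i * qPoch (a * d) q i /
      (a ^ i * qPoch (a * b * c * d * q ^ ((i : ℤ) - 1)) q i)) * askeyWilson q a b c d i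

open LaurentPolynomial in
/-- The Laurent polynomial
`g[y] = b (1 - s* q²) (1 - s* q³) / ((1 - s* q / r₁) (1 - s* q / r₂)) (y - a - b + q^{-D} y⁻¹)`,
where `a = (r₁ r₂ / (s* q^D))^{1/2}` and `b = (s* / (r₁ r₂ q^D))^{1/2}`. -/
def gPoly (D : ℕ) (q ss r₁ r₂ a b : ℂ) : ℂ[T;T⁻¹] :=
  C (b * ((1 - ss * q ^ 2) * (1 - ss * q ^ 3) / ((1 - ss * q / r₁) * (1 - ss * q / r₂)))) *
    (T 1 - C a - C b + C (1 / q ^ D) * T (-1))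

open LaurentPolynomial in
/-- `ε_j⁺`, `0 ≤ j ≤ D - 1`, in terms of the scalars `k i = k_i` and `kp i = k_i^⊥`; here
`p_i^⊥ = p_i(y + y⁻¹; a q, b q, c, d | q)`. -/
def epsPlus (D : ℕ) (q ss r₁ r₂ a b c d : ℂ) (k kp : ℕ → ℂ) (j : ℕ) : ℂ[T;T⁻¹] :=
  if j + 1 = D then C (k D) * askeyWilson q a b c d D
  else
    C (eps D q ss (j + 1) / (eps D q ss (j + 1) - 1) * k (j + 1)) *
        askeyWilson q a b c d (j + 1) +
      C (1 / (xi D q ss (j + 1) * (1 - eps D q ss (j + 1))) * kp j) *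
        askeyWilson q (a * q) (b * q) c d j * gPoly D q ss r₁ r₂ a b

open LaurentPolynomial in
/-- `ε_i⁻`, `0 ≤ i ≤ D - 1`, in terms of the scalars `k i = k_i` and `kp i = k_i^⊥`. -/
def epsMinus (D : ℕ) (q ss r₁ r₂ a b c d : ℂ) (k kp : ℕ → ℂ) (i : ℕ) : ℂ[T;T⁻¹] :=
  if i = 0 then 1
  else
    C (1 / (1 - eps D q ss i) * k i) * askeyWilson q a b c d i +
      C (1 / (xi D q ss i * (eps D q ss i - 1)) * kp (i - 1)) *
        askeyWilson q (a * q) (b * q) c d (i - 1) * gPoly D q ss r₁ r₂ a b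

end

end NonsymRacah

open NonsymRacah LaurentPolynomial

/-! Since `ab = q^{-D}`, the bracket in `g` equals `Y = y(1 - a/y)(1 - b/y)`. Write `P_i = F p_i`,
`P_{i-1}^⊥ = F' p_{i-1}^⊥` with scalars `F`, `F'`. Both sides are then combinations of `p_i` and `Y
p_{i-1}^⊥`, and no property of the Askey-Wilson polynomials is needed. With `M` the q-Pochhammer
quotient on the right and `g₀` the constant factor of `g`, it suffices that `M F = k_i`
(`mul_monicFactor`, and `mul_monicFactor_last` for `i = D`) and `k_{i-1}^⊥ g₀ / ξ_i = ϵ_i M F'`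
(from `kPerp_eq_kNum` and `monicFactor_perp`).

The numbers `k_i` come from the parameter array. Vectors of `M x̂` are constant on the spheres about
`x`, so a split basis has coefficients `γ i j` on which `A` and `A*` impose recurrences
(`IsSplitCoeff`). The near-diagonal coefficients express `a_i` through `φ`. The last vector of a
split basis is an eigenvector of `A`: for the reversed ordering its eigenvalue is the valency, so it
is constant, which yields `c_i` through `ϕ`. Then `b_i` follows from `c_i + a_i + b_i = θ_0`.

For `k_i^⊥` the entries `b_i^⊥`, `c_i^⊥` are never computed. As `A` is symmetric, `b_i^⊥ /
c_{i+1}^⊥` is a ratio of squared lengths of `v_{i+1}^⊥` and `v_i^⊥`, and only the cell sizes are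
needed (`kPerp_eq`). The characteristic vector of a Delsarte clique is orthogonal to the eigenspace
of `θ_D` (`sum_clique_eq_zero`), so the cosines of `θ_D` sum to zero over the clique as seen from
any vertex. The last vector of the first split basis gives these cosines, with consecutive ratios
`ϕ/φ` (`last_ratio`), and the cell sizes follow by recursion (`cell_ncard`). -/

namespace NonsymRacah

/-! ### Distance-regular graphs: radial vectors and intersection numbers. -/

section DistanceRegular

set_option linter.unusedSectionVars false

variable {X : Type*} [Fintype X] [DecidableEq X]

theorem distMatrix_one_mulVec (G : SimpleGraph X) (v : X → ℂ) (y : X) :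
    (distMatrix G 1 *ᵥ v) y = ∑ z, if G.dist y z = 1 then v z else 0 := by
  simp [distMatrix, mulVec, dotProduct]

theorem sum_ite_eq_ncard {p : X → Prop} [DecidablePred p] (t : ℂ) :
    (∑ z, if p z then t else 0) = ({z | p z}.ncard : ℂ) * t := by
  rw [← Finset.sum_filter, Finset.sum_const, nsmul_eq_mul, Set.ncard_eq_toFinset_card']
  simp

variable {G : SimpleGraph X} {a b c : ℕ → ℕ}

/-- Neighbours of `y` are sorted by their distance to `x`, which differs from that of `y` by at most
one. At `y = x` the index `0 - 1` truncates to `0`; this is harmless because `c 0 = 0`. -/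
theorem IsDistanceRegular.mulVec_radial (hG : IsDistanceRegular G a b c) (x y : X) (γ : ℕ → ℂ) :
    (distMatrix G 1 *ᵥ fun z => γ (G.dist x z)) y =
      c (G.dist x y) * γ (G.dist x y - 1) + a (G.dist x y) * γ (G.dist x y) +
        b (G.dist x y) * γ (G.dist x y + 1) := by
  classical
  rw [distMatrix_one_mulVec, ← hG.card_closer x y, ← hG.card_same x y, ← hG.card_farther x y,
    ← sum_ite_eq_ncard, ← sum_ite_eq_ncard, ← sum_ite_eq_ncard, ← Finset.sum_add_distrib,
    ← Finset.sum_add_distrib]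
  refine Finset.sum_congr rfl fun z _ => ?_
  simp only [SimpleGraph.dist_eq_one_iff_adj]
  by_cases h : G.Adj y z
  · have h3 := h.diff_dist_adj (u := x)
    simp only [h, if_true, true_and]
    generalize G.dist x z = m at h3 ⊢
    generalize G.dist x y = n at h3 ⊢
    by_cases h1 : m = n
    · subst h1
      simp
    by_cases h2 : m = n + 1
    · subst h2
      have : ¬ n + 1 + 1 = n := by omega
      simp [this]
    have h4 : m = n - 1 := by omega
    have h5 : m + 1 = n := by omega
    simp [h1, h2, h5, ← h4]
  · simp [h]

theorem exists_adj_dist_eq (hG : G.Connected) {x y : X} {i : ℕ} (h : G.dist x y = i + 1) :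
    ∃ z, G.Adj z y ∧ G.dist x z = i := by
  obtain ⟨p, hp⟩ := hG.exists_walk_length_eq_dist y x
  rw [SimpleGraph.dist_comm, h] at hp
  cases p with
  | nil => simp at hp
  | @cons _ w _ hadj p =>
    refine ⟨w, hadj.symm, ?_⟩
    have h1 : p.length = i := by simpa using hp
    have h2 := SimpleGraph.dist_le p
    have h3 := hadj.diff_dist_adj (u := x)
    rw [SimpleGraph.dist_comm] at h2
    omega

theorem IsDistanceRegular.b_ne_zero_of_adj (hG : IsDistanceRegular G a b c) {x y z : X}
    (h : G.Adj y z) (h' : G.dist x z = G.dist x y + 1) : b (G.dist x y) ≠ 0 := by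
  rw [← hG.card_farther x y]
  exact Set.ncard_ne_zero_of_mem (a := z) ⟨h, h'⟩

theorem IsDistanceRegular.b_ne_zero (hG : IsDistanceRegular G a b c) {i : ℕ} (hi : i < G.diam) :
    b i ≠ 0 := by
  have := hG.connected.nonempty
  obtain ⟨u, v, huv⟩ := G.exists_dist_eq_diam
  have h : ∀ n, ∀ v, G.dist u v = i + 1 + n → b i ≠ 0 := by
    intro n
    induction n with
    | zero =>
      intro v hv
      obtain ⟨z, hz, hz'⟩ := exists_adj_dist_eq hG.connected hv
      rw [← hz']
      exact hG.b_ne_zero_of_adj hz (by omega)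
    | succ n ih =>
      intro v hv
      obtain ⟨z, -, hz'⟩ := exists_adj_dist_eq (i := i + 1 + n) hG.connected hv
      exact ih z hz'
  exact h (G.diam - (i + 1)) v (by omega)

/-- Since `b i ≠ 0` below the diameter, one can always move one step outward. Nonempty spheres about
every vertex are what allow identities between radial vectors to be read as identities between
coefficients. -/
theorem IsDistanceRegular.exists_dist_eq (hG : IsDistanceRegular G a b c) (x : X) {i : ℕ}
    (hi : i ≤ G.diam) : ∃ y, G.dist x y = i := by
  induction i with
  | zero => exact ⟨x, SimpleGraph.dist_self⟩
  | succ i ih =>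
    obtain ⟨y, hy⟩ := ih (by omega)
    have h := hG.b_ne_zero (i := i) (by omega)
    rw [← hy, ← hG.card_farther x y] at h
    obtain ⟨z, hz⟩ := Set.nonempty_of_ncard_ne_zero h
    exact ⟨z, by rw [hz.2, hy]⟩

theorem IsDistanceRegular.c_ne_zero (hG : IsDistanceRegular G a b c) {i : ℕ}
    (hi : i + 1 ≤ G.diam) : c (i + 1) ≠ 0 := by
  have x := hG.connected.nonempty.some
  obtain ⟨y, hy⟩ := hG.exists_dist_eq x hi
  obtain ⟨z, hz, hz'⟩ := exists_adj_dist_eq hG.connected hy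
  rw [← hy, ← hG.card_closer x y]
  exact Set.ncard_ne_zero_of_mem (a := z) ⟨hz.symm, by omega⟩

theorem IsDistanceRegular.c_zero (hG : IsDistanceRegular G a b c) : c 0 = 0 := by
  have x := hG.connected.nonempty.some
  have h := hG.card_closer x x
  simpa using h.symm

theorem IsDistanceRegular.a_zero (hG : IsDistanceRegular G a b c) : a 0 = 0 := by
  have x := hG.connected.nonempty.some
  have h := hG.card_same x x
  rw [SimpleGraph.dist_self] at h
  rw [← h, Set.ncard_eq_zero]
  ext z
  simp only [Set.mem_ofPred_eq, Set.mem_empty_iff_false, iff_false, not_and]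
  intro h1 h2
  rw [hG.connected.dist_eq_zero_iff] at h2
  exact h1.ne h2

theorem IsDistanceRegular.dist_le (hG : IsDistanceRegular G a b c) (x y : X) :
    G.dist x y ≤ G.diam := by
  have := hG.connected.nonempty
  exact SimpleGraph.dist_le_diam (SimpleGraph.connected_iff_ediam_ne_top.1 hG.connected)

theorem IsDistanceRegular.b_diam (hG : IsDistanceRegular G a b c) : b G.diam = 0 := by
  have x := hG.connected.nonempty.some
  obtain ⟨y, hy⟩ := hG.exists_dist_eq x le_rfl
  rw [← hy, ← hG.card_farther x y, Set.ncard_eq_zero]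
  ext z
  simp only [Set.mem_ofPred_eq, Set.mem_empty_iff_false, iff_false, not_and]
  intro _ h2
  have := hG.dist_le x z
  omega

/-- The value at `y` of `A` applied to the all-ones vector is expanded twice, about `x` and about
`y` itself. -/
theorem IsDistanceRegular.sum_eq (hG : IsDistanceRegular G a b c) {i : ℕ} (hi : i ≤ G.diam) :
    (c i : ℂ) + a i + b i = b 0 := by
  have x := hG.connected.nonempty.some
  obtain ⟨y, hy⟩ := hG.exists_dist_eq x hi
  have h1 := hG.mulVec_radial x y (fun _ => 1)
  have h2 := hG.mulVec_radial y y (fun _ => 1)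
  rw [h1, SimpleGraph.dist_self, hy, hG.c_zero, hG.a_zero] at h2
  simpa using h2

/-- In a `Q`-polynomial ordering, the first eigenvalue is the valency. -/
theorem IsEigenOrdering.theta_zero (hG : IsDistanceRegular G a b c) {D : ℕ} {θ : ℕ → ℝ}
    {E : ℕ → Matrix X X ℂ} (hE : IsEigenOrdering G D θ E) (hQ : IsQPolynomial D E) :
    (θ 0 : ℂ) = b 0 := by
  obtain ⟨f, hf, hf'⟩ := hQ 0 (Nat.zero_le _)
  have x := hG.connected.nonempty.some
  have hX : (Fintype.card X : ℂ) ≠ 0 := by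
    have : Nonempty X := ⟨x⟩
    exact_mod_cast Fintype.card_ne_zero
  -- A polynomial of degree 0 makes `E 0` entrywise constant, equal to some `α ≠ 0`. Idempotency
  -- forces `|X| α = 1`, so `E 0` fixes the all-ones vector, whose eigenvalue is the valency.
  rw [Polynomial.eq_C_of_degree_eq_zero hf] at hf'
  have ha : f.coeff 0 ≠ 0 := Polynomial.coeff_ne_zero_of_eq_degree hf
  set α := f.coeff 0
  simp only [Polynomial.eval_C] at hf'
  have hid := congrFun (congrFun (hE.idempotent 0 (Nat.zero_le _)) x) x
  simp only [mul_apply, hf', Finset.sum_const, Finset.card_univ, nsmul_eq_mul] at hid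
  have h1 : (Fintype.card X : ℂ) * α = 1 := by
    apply mul_right_cancel₀ ha
    linear_combination hid
  have h2 : E 0 *ᵥ (fun _ => (1 : ℂ)) = fun _ => 1 := by
    ext y
    simp [mulVec, dotProduct, hf', h1]
  have h3 := congrFun ((hE.range_iff 0 (Nat.zero_le _) _).1 h2) x
  have h4 := hG.mulVec_radial x x (fun _ => 1)
  rw [h4, SimpleGraph.dist_self, hG.c_zero, hG.a_zero] at h3
  simpa using h3.symm

/-- The vectors of `M x̂` are constant on the spheres around `x`. -/
theorem IsDistanceRegular.exists_radial (hG : IsDistanceRegular G a b c) {x : X} {v : X → ℂ}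
    (hv : v ∈ primaryModule G x) : ∃ γ : ℕ → ℂ, v = fun y => γ (G.dist x y) := by
  unfold primaryModule at hv
  induction hv using Submodule.span_induction with
  | mem v hv =>
    obtain ⟨n, rfl⟩ := hv
    dsimp only
    induction n with
    | zero =>
      refine ⟨fun i => if i = 0 then 1 else 0, ?_⟩
      ext y
      simp only [pow_zero, one_mulVec, hG.connected.dist_eq_zero_iff]
      by_cases h : x = y
      · simp [charVec, h]
      · simp [charVec, h, Ne.symm h]
    | succ n ih =>
      obtain ⟨γ, hγ⟩ := ih
      refine ⟨fun i => c i * γ (i - 1) + a i * γ i + b i * γ (i + 1), ?_⟩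
      ext y
      rw [pow_succ', ← mulVec_mulVec, hγ, hG.mulVec_radial]
  | zero => exact ⟨0, rfl⟩
  | add v w _ _ hv hw =>
    obtain ⟨γ, rfl⟩ := hv
    obtain ⟨δ, rfl⟩ := hw
    exact ⟨γ + δ, rfl⟩
  | smul t v _ hv =>
    obtain ⟨γ, rfl⟩ := hv
    exact ⟨t • γ, rfl⟩

end DistanceRegular

/-! ### Split bases in radial coordinates. -/

section SplitCoefficients

/-- The coefficients `γ i j` of the vectors of a split basis with respect to the characteristic
vectors of the spheres around the base vertex. -/
structure IsSplitCoeff (D : ℕ) (a b c θ θs φ : ℕ → ℂ) (γ : ℕ → ℕ → ℂ) : Prop where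
  raise : ∀ i < D, ∀ j ≤ D,
    c j * γ i (j - 1) + a j * γ i j + b j * γ i (j + 1) = θ i * γ i j + γ (i + 1) j
  top : ∀ j ≤ D, c j * γ D (j - 1) + a j * γ D j + b j * γ D (j + 1) = θ D * γ D j
  bot : ∀ j ≤ D, θs j * γ 0 j = θs 0 * γ 0 j
  lower : ∀ i < D, ∀ j ≤ D,
    θs j * γ (i + 1) j = θs (i + 1) * γ (i + 1) j + φ (i + 1) * γ i j
  ne : ∃ j ≤ D, γ 0 j ≠ 0

variable {D : ℕ} {a b c θ θs φ : ℕ → ℂ} {γ : ℕ → ℕ → ℂ}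

namespace IsSplitCoeff

/-- `A*` multiplies the `j`-th coordinate by `θs j`, and these values are distinct. So `u_0` lives
on the sphere of radius 0, and each later vector reaches at most one sphere further. -/
theorem eq_zero (h : IsSplitCoeff D a b c θ θs φ γ)
    (hθs : ∀ i ≤ D, ∀ j ≤ D, θs i = θs j → i = j) {i j : ℕ} (hij : i < j) (hj : j ≤ D) :
    γ i j = 0 := by
  induction i with
  | zero =>
    have h1 := h.bot j hj
    have h2 : θs j - θs 0 ≠ 0 := fun h3 => by
      have := hθs j hj 0 (by omega) (sub_eq_zero.1 h3)
      omega
    apply mul_left_cancel₀ h2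
    linear_combination h1
  | succ i ih =>
    have h1 := h.lower i (by omega) j hj
    rw [ih (by omega)] at h1
    have h2 : θs j - θs (i + 1) ≠ 0 := fun h3 => by
      have := hθs j hj (i + 1) (by omega) (sub_eq_zero.1 h3)
      omega
    apply mul_left_cancel₀ h2
    linear_combination h1

/-- In the `(i+1)`-st coordinate of `A u_i = θ_i u_i + u_{i+1}` triangularity kills all but one
term. When `i + 1 = D` the out-of-range coordinate is killed by `b D = 0` instead. -/
theorem diag_succ (h : IsSplitCoeff D a b c θ θs φ γ)
    (hθs : ∀ i ≤ D, ∀ j ≤ D, θs i = θs j → i = j) (hb : b D = 0) {i : ℕ} (hi : i < D) :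
    γ (i + 1) (i + 1) = c (i + 1) * γ i i := by
  have h1 := h.raise i hi (i + 1) hi
  have h2 : b (i + 1) * γ i (i + 1 + 1) = 0 := by
    rcases Nat.lt_or_ge (i + 1) D with h3 | h3
    · rw [h.eq_zero hθs (show i < i + 1 + 1 by omega) h3, mul_zero]
    · rw [show i + 1 = D by omega, hb, zero_mul]
  rw [h2, h.eq_zero hθs (show i < i + 1 by omega) hi, Nat.add_sub_cancel] at h1
  linear_combination -h1

theorem diag_ne_zero (h : IsSplitCoeff D a b c θ θs φ γ)
    (hθs : ∀ i ≤ D, ∀ j ≤ D, θs i = θs j → i = j) (hb : b D = 0)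
    (hc : ∀ i < D, c (i + 1) ≠ 0) {i : ℕ} (hi : i ≤ D) : γ i i ≠ 0 := by
  induction i with
  | zero =>
    obtain ⟨j, hj, hj'⟩ := h.ne
    rcases Nat.eq_zero_or_pos j with rfl | h1
    · exact hj'
    · exact absurd (h.eq_zero hθs h1 hj) hj'
  | succ i ih =>
    rw [h.diag_succ hθs hb hi]
    exact mul_ne_zero (hc i hi) (ih (by omega))

theorem a_zero (h : IsSplitCoeff D a b c θ θs φ γ)
    (hθs : ∀ i ≤ D, ∀ j ≤ D, θs i = θs j → i = j) (hb : b D = 0)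
    (hc : ∀ i < D, c (i + 1) ≠ 0) (hc0 : c 0 = 0) (hD : 0 < D) :
    (a 0 - θ 0) * (θs 0 - θs 1) = φ 1 := by
  have h0 := h.diag_ne_zero hθs hb hc (Nat.zero_le D)
  have h1 := h.raise 0 hD 0 (Nat.zero_le D)
  have h2 := h.lower 0 hD 0 (Nat.zero_le D)
  rw [hc0, zero_mul, h.eq_zero hθs (show 0 < 0 + 1 by omega) hD] at h1
  apply mul_right_cancel₀ h0
  simp only [Nat.zero_add] at h1 h2
  linear_combination (θs 0 - θs 1) * h1 + h2

/-- The diagonal coordinate of `raise` involves only diagonal and subdiagonal coefficients, and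
`lower` expresses the latter through `φ`. The result is `a_i = θ_i + φ_{i+1}/(θ*_i - θ*_{i+1}) +
φ_i/(θ*_i - θ*_{i-1})`, cleared of denominators and with `i` shifted by one. -/
theorem a_succ (h : IsSplitCoeff D a b c θ θs φ γ)
    (hθs : ∀ i ≤ D, ∀ j ≤ D, θs i = θs j → i = j) (hb : b D = 0)
    (hc : ∀ i < D, c (i + 1) ≠ 0) {i : ℕ} (hi : i + 1 < D) :
    (a (i + 1) - θ (i + 1)) * ((θs (i + 1) - θs (i + 2)) * (θs i - θs (i + 1))) =
      φ (i + 2) * (θs i - θs (i + 1)) - φ (i + 1) * (θs (i + 1) - θs (i + 2)) := by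
  have h0 := h.diag_ne_zero hθs hb hc (show i + 1 ≤ D by omega)
  have h1 := h.raise (i + 1) hi (i + 1) (by omega)
  have h2 := h.lower (i + 1) hi (i + 1) (by omega)
  have h3 := h.lower i (by omega) i (by omega)
  have h4 := h.diag_succ hθs hb (show i < D by omega)
  rw [Nat.add_sub_cancel, h.eq_zero hθs (show i + 1 < i + 1 + 1 by omega) (by omega)] at h1
  apply mul_right_cancel₀ h0
  simp only [Nat.add_assoc, Nat.reduceAdd] at h1 h2
  linear_combination (θs (i + 1) - θs (i + 2)) * (θs i - θs (i + 1)) * h1 +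
    (θs i - θs (i + 1)) * h2 - c (i + 1) * (θs (i + 1) - θs (i + 2)) * h3 +
    φ (i + 1) * (θs (i + 1) - θs (i + 2)) * h4

theorem mul_prod (h : IsSplitCoeff D a b c θ θs φ γ) {i j : ℕ} (hij : j ≤ i) (hi : i ≤ D) :
    γ i j * ∏ l ∈ Finset.Ico (j + 1) (i + 1), (θs j - θs l) =
      (∏ l ∈ Finset.Ico (j + 1) (i + 1), φ l) * γ j j := by
  induction i, hij using Nat.le_induction with
  | base => simp
  | succ i hij ih =>
    rw [Finset.prod_Ico_succ_top (show j + 1 ≤ i + 1 by omega),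
      Finset.prod_Ico_succ_top (show j + 1 ≤ i + 1 by omega)]
    have h1 := h.lower i (by omega) j (by omega)
    linear_combination φ (i + 1) * ih (by omega) +
      (∏ l ∈ Finset.Ico (j + 1) (i + 1), (θs j - θs l)) * h1

/-- Iterating `lower` ties each coordinate of the last vector to a diagonal coefficient; consecutive
diagonal coefficients differ by the factor `c_{j+1}`. -/
theorem last_succ (h : IsSplitCoeff D a b c θ θs φ γ)
    (hθs : ∀ i ≤ D, ∀ j ≤ D, θs i = θs j → i = j) (hb : b D = 0) {j : ℕ} (hj : j < D) :
    γ D j * c (j + 1) * ∏ l ∈ Finset.Ico (j + 1) (D + 1), (θs j - θs l) =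
      γ D (j + 1) * φ (j + 1) * ∏ l ∈ Finset.Ico (j + 2) (D + 1), (θs (j + 1) - θs l) := by
  have h1 := h.mul_prod (show j ≤ D by omega) le_rfl
  have h2 := h.mul_prod (show j + 1 ≤ D by omega) le_rfl
  rw [Finset.prod_eq_prod_Ico_succ_bot (show j + 1 < D + 1 by omega) φ] at h1
  linear_combination c (j + 1) * h1 - φ (j + 1) * h2 -
    φ (j + 1) * (∏ l ∈ Finset.Ico (j + 2) (D + 1), φ l) * h.diag_succ hθs hb hj

theorem last_ne_zero (h : IsSplitCoeff D a b c θ θs φ γ)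
    (hθs : ∀ i ≤ D, ∀ j ≤ D, θs i = θs j → i = j) (hb : b D = 0)
    (hc : ∀ i < D, c (i + 1) ≠ 0) (hφ : ∀ i < D, φ (i + 1) ≠ 0) {j : ℕ} (hj : j ≤ D) :
    γ D j ≠ 0 := by
  have h1 := h.mul_prod hj le_rfl
  intro h2
  rw [h2, zero_mul] at h1
  refine mul_ne_zero (Finset.prod_ne_zero_iff.2 fun l hl => ?_)
    (h.diag_ne_zero hθs hb hc hj) h1.symm
  obtain ⟨h3, h4⟩ := Finset.mem_Ico.1 hl
  obtain ⟨m, rfl⟩ : ∃ m, l = m + 1 := ⟨l - 1, by omega⟩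
  exact hφ m (by omega)

/-- An eigenvector for the row sum of a tridiagonal matrix is constant: starting from `c 0 = 0`, the
three-term recurrence forces consecutive values to agree because `b j ≠ 0`. -/
theorem last_const (h : IsSplitCoeff D a b c θ θs φ γ) (hc0 : c 0 = 0)
    (hb : ∀ j < D, b j ≠ 0) (hsum : ∀ j ≤ D, c j + a j + b j = θ D) {j : ℕ} (hj : j ≤ D) :
    γ D j = γ D 0 := by
  have key : ∀ j < D, γ D (j + 1) = γ D j := by
    intro j
    induction j with
    | zero =>
      intro hj
      have h1 := h.top 0 (Nat.zero_le D)
      have h2 := hsum 0 (Nat.zero_le D)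
      apply mul_left_cancel₀ (hb 0 hj)
      rw [hc0] at h1 h2
      linear_combination h1 - γ D 0 * h2
    | succ j ih =>
      intro hj
      have h1 := h.top (j + 1) hj.le
      have h2 := hsum (j + 1) hj.le
      rw [Nat.add_sub_cancel] at h1
      apply mul_left_cancel₀ (hb (j + 1) hj)
      linear_combination h1 - γ D (j + 1) * h2 + c (j + 1) * ih (by omega)
  induction j with
  | zero => rfl
  | succ j ih => rw [key j hj, ih (by omega)]

end IsSplitCoeff

theorem prod_sub_ne_zero (hθs : ∀ i ≤ D, ∀ j ≤ D, θs i = θs j → i = j) {j : ℕ} :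
    ∏ l ∈ Finset.Ico (j + 1) (D + 1), (θs j - θs l) ≠ 0 := by
  refine Finset.prod_ne_zero_iff.2 fun l hl h3 => ?_
  obtain ⟨h1, h2⟩ := Finset.mem_Ico.1 hl
  have := hθs j (by omega) l (by omega) (sub_eq_zero.1 h3)
  omega

/-- Meant for the reversed ordering, where `θ D` stands for the valency. The last vector is then a
nonzero constant and cancels from `last_succ`. -/
theorem IsSplitCoeff.c_succ {ϕ : ℕ → ℂ} (h : IsSplitCoeff D a b c θ θs ϕ γ)
    (hθs : ∀ i ≤ D, ∀ j ≤ D, θs i = θs j → i = j) (hb : b D = 0)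
    (hc : ∀ i < D, c (i + 1) ≠ 0) (hϕ : ∀ i < D, ϕ (i + 1) ≠ 0) (hc0 : c 0 = 0)
    (hb0 : ∀ j < D, b j ≠ 0) (hsum : ∀ j ≤ D, c j + a j + b j = θ D) {j : ℕ} (hj : j < D) :
    c (j + 1) * ∏ l ∈ Finset.Ico (j + 1) (D + 1), (θs j - θs l) =
      ϕ (j + 1) * ∏ l ∈ Finset.Ico (j + 2) (D + 1), (θs (j + 1) - θs l) := by
  have h1 := h.last_succ hθs hb hj
  have h0 := h.last_ne_zero hθs hb hc hϕ (Nat.zero_le D)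
  rw [h.last_const hc0 hb0 hsum (show j ≤ D by omega),
    h.last_const hc0 hb0 hsum (show j + 1 ≤ D by omega)] at h1
  apply mul_left_cancel₀ h0
  linear_combination h1

/-- The ratios of consecutive cosines of the last eigenvalue. -/
theorem IsSplitCoeff.last_ratio {ϕ : ℕ → ℂ} (h : IsSplitCoeff D a b c θ θs φ γ)
    (hθs : ∀ i ≤ D, ∀ j ≤ D, θs i = θs j → i = j) (hb : b D = 0)
    {j : ℕ} (hj : j < D)
    (hcs : c (j + 1) * ∏ l ∈ Finset.Ico (j + 1) (D + 1), (θs j - θs l) =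
      ϕ (j + 1) * ∏ l ∈ Finset.Ico (j + 2) (D + 1), (θs (j + 1) - θs l)) :
    γ D (j + 1) * φ (j + 1) = γ D j * ϕ (j + 1) := by
  have h1 := h.last_succ hθs hb hj
  apply mul_right_cancel₀ (prod_sub_ne_zero hθs (j := j + 1))
  linear_combination -h1 + γ D j * hcs

end SplitCoefficients

section

variable {X : Type*} [Fintype X] [DecidableEq X] {G : SimpleGraph X} {a b c : ℕ → ℕ}

/-- Split basis vectors lie in `M x̂`, hence are radial, and each vector identity is evaluated at
one vertex of each sphere. -/
theorem IsDistanceRegular.exists_splitCoeff (hG : IsDistanceRegular G a b c) {x : X}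
    {E : ℕ → Matrix X X ℂ} {θ θs φ : ℕ → ℂ} (hθs : IsDualEigenvalues G E x θs)
    (h : IsSplitSequence (distMatrix G 1) (dualAdj E x) (primaryModule G x) G.diam θ θs φ) :
    ∃ γ, IsSplitCoeff G.diam (fun i => a i) (fun i => b i) (fun i => c i) θ θs φ γ := by
  obtain ⟨u, hli, hspan, hA, hAD, hAs, hAss⟩ := h
  have hmem : ∀ i ≤ G.diam, u i ∈ primaryModule G x := fun i hi => by
    rw [← hspan]
    exact Submodule.subset_span ⟨⟨i, by omega⟩, rfl⟩
  have hrad : ∀ i, ∃ γ : ℕ → ℂ, i ≤ G.diam → u i = fun y => γ (G.dist x y) := by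
    intro i
    by_cases hi : i ≤ G.diam
    · obtain ⟨γ, hγ⟩ := hG.exists_radial (hmem i hi)
      exact ⟨γ, fun _ => hγ⟩
    · exact ⟨0, fun h => absurd h hi⟩
  choose γ hγ using hrad
  have hAs' : ∀ (v : X → ℂ) y, (dualAdj E x *ᵥ v) y = θs (G.dist x y) * v y := by
    intro v y
    rw [← hθs y]
    simp [dualAdj, mulVec_diagonal]
  refine ⟨γ, ?_, ?_, ?_, ?_, ?_⟩
  · intro i hi j hj
    obtain ⟨y, rfl⟩ := hG.exists_dist_eq x hj
    rw [← hG.mulVec_radial, ← hγ i hi.le, hA i hi, hγ i hi.le, hγ (i + 1) hi]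
    rfl
  · intro j hj
    obtain ⟨y, rfl⟩ := hG.exists_dist_eq x hj
    rw [← hG.mulVec_radial, ← hγ _ le_rfl, hAD, hγ _ le_rfl]
    rfl
  · intro j hj
    obtain ⟨y, rfl⟩ := hG.exists_dist_eq x hj
    have h1 := congrFun hAs y
    rw [hAs', hγ 0 (Nat.zero_le _)] at h1
    exact h1
  · intro i hi j hj
    obtain ⟨y, rfl⟩ := hG.exists_dist_eq x hj
    have h1 := congrFun (hAss i hi) y
    rw [hAs', hγ i hi.le, hγ (i + 1) hi] at h1
    exact h1
  · by_contra! h0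
    refine hli.ne_zero (⟨0, by omega⟩ : Fin (G.diam + 1)) ?_
    change u 0 = 0
    rw [hγ 0 (Nat.zero_le _)]
    ext y
    exact h0 _ (hG.dist_le x y)

end

/-! ### Intersection numbers computed from a q-Racah array. -/

namespace IsQRacah

variable {D : ℕ} {q h hs s ss r₁ r₂ : ℂ} {θ θs φ ϕ : ℕ → ℂ}

theorem thetas_sub (H : IsQRacah D q h hs s ss r₁ r₂ θ θs φ ϕ) (hq0 : q ≠ 0) {i l : ℕ}
    (hi : i ≤ D) (hl : l ≤ D) :
    θs i - θs l = hs * (q ^ l - q ^ i) * (1 - ss * (q ^ i * q ^ l * q)) / (q ^ i * q ^ l) := by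
  rw [H.thetas i hi, H.thetas l hl, pow_succ, pow_succ]
  have h1 : q ^ i ≠ 0 := pow_ne_zero i hq0
  have h2 : q ^ l ≠ 0 := pow_ne_zero l hq0
  generalize q ^ i = Q at *
  generalize q ^ l = L at *
  field_simp
  ring

theorem pow_ne_pow (hq0 : q ≠ 0) (hq : ∀ n : ℕ, 0 < n → q ^ n ≠ 1) {i j : ℕ} (hij : i ≠ j) :
    q ^ i ≠ q ^ j := by
  have key : ∀ i j : ℕ, i < j → q ^ i ≠ q ^ j := by
    intro i j hij h1
    obtain ⟨n, rfl⟩ := Nat.exists_eq_add_of_lt hij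
    apply hq (n + 1) (by omega)
    apply mul_left_cancel₀ (pow_ne_zero i hq0)
    rw [← pow_add, mul_one, h1]
    rfl
  rcases Nat.lt_or_gt_of_ne hij with h1 | h1
  · exact key i j h1
  · exact (key j i h1).symm

theorem one_sub_ss_ne_zero (H : IsQRacah D q h hs s ss r₁ r₂ θ θs φ ϕ) {i : ℕ}
    (hi : 2 ≤ i) (hi' : i ≤ 2 * D) : 1 - ss * q ^ i ≠ 0 :=
  sub_ne_zero.2 (H.nondeg_s i hi hi').2.symm

theorem thetas_injOn (H : IsQRacah D q h hs s ss r₁ r₂ θ θs φ ϕ) (hq0 : q ≠ 0)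
    (hq : ∀ n : ℕ, 0 < n → q ^ n ≠ 1) : ∀ i ≤ D, ∀ j ≤ D, θs i = θs j → i = j := by
  intro i hi j hj hij
  by_contra hne
  have h1 := H.thetas_sub hq0 hi hj
  rw [hij, sub_self, ← pow_add, ← pow_succ] at h1
  refine div_ne_zero (mul_ne_zero (mul_ne_zero H.hs_ne ?_) ?_) (pow_ne_zero _ hq0) h1.symm
  · exact sub_ne_zero.2 (pow_ne_pow hq0 hq (Ne.symm hne))
  · exact H.one_sub_ss_ne_zero (by omega) (by omega)

theorem phi_one_succ (H : IsQRacah D q h hs s ss r₁ r₂ θ θs φ ϕ) (hq0 : q ≠ 0) {i : ℕ}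
    (hi : i < D) :
    φ (i + 1) = h * hs * (1 - q ^ i * q) * (1 - q ^ i / q ^ D) * (1 - r₁ * (q ^ i * q)) *
      (1 - r₂ * (q ^ i * q)) / (q * (q ^ i) ^ 2) := by
  rw [H.phi_one (i + 1) (by omega) hi]
  have h1 : q ^ (1 - 2 * ((i + 1 : ℕ) : ℤ)) = 1 / (q * (q ^ i) ^ 2) := by
    rw [show 1 - 2 * ((i + 1 : ℕ) : ℤ) = -((2 * i + 1 : ℕ) : ℤ) by push_cast; ring, _root_.zpow_neg,
      zpow_natCast, one_div, pow_succ, pow_mul', mul_comm]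
  have h2 : q ^ (((i + 1 : ℕ) : ℤ) - D - 1) = q ^ i / q ^ D := by
    rw [show ((i + 1 : ℕ) : ℤ) - D - 1 = (i : ℤ) - D by push_cast; ring, zpow_sub₀ hq0,
      zpow_natCast, zpow_natCast]
  rw [h1, h2, pow_succ q i]
  ring

theorem phi_two_succ (H : IsQRacah D q h hs s ss r₁ r₂ θ θs φ ϕ) (hq0 : q ≠ 0) {i : ℕ}
    (hi : i < D) :
    ϕ (i + 1) = h * hs * (1 - q ^ i * q) * (1 - q ^ i / q ^ D) * (r₁ - ss * (q ^ i * q)) *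
      (r₂ - ss * (q ^ i * q)) / (ss * (q * (q ^ i) ^ 2)) := by
  rw [H.phi_two (i + 1) (by omega) hi]
  have h1 : q ^ (1 - 2 * ((i + 1 : ℕ) : ℤ)) = 1 / (q * (q ^ i) ^ 2) := by
    rw [show 1 - 2 * ((i + 1 : ℕ) : ℤ) = -((2 * i + 1 : ℕ) : ℤ) by push_cast; ring, _root_.zpow_neg,
      zpow_natCast, one_div, pow_succ, pow_mul', mul_comm]
  have h2 : q ^ (((i + 1 : ℕ) : ℤ) - D - 1) = q ^ i / q ^ D := by
    rw [show ((i + 1 : ℕ) : ℤ) - D - 1 = (i : ℤ) - D by push_cast; ring, zpow_sub₀ hq0,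
      zpow_natCast, zpow_natCast]
  rw [h1, h2, pow_succ q i]
  field_simp [H.ss_ne]

theorem one_sub_ne_zero (hq : ∀ n : ℕ, 0 < n → q ^ n ≠ 1) (i : ℕ) : 1 - q ^ i * q ≠ 0 := by
  rw [← pow_succ]
  exact sub_ne_zero.2 (hq (i + 1) (by omega)).symm

theorem one_sub_div_ne_zero (hq0 : q ≠ 0) (hq : ∀ n : ℕ, 0 < n → q ^ n ≠ 1) {i : ℕ} (hi : i < D) :
    1 - q ^ i / q ^ D ≠ 0 := by
  intro h1
  have h2 : q ^ D ≠ 0 := pow_ne_zero D hq0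
  rw [sub_eq_zero, eq_div_iff h2, one_mul] at h1
  exact pow_ne_pow hq0 hq hi.ne' h1

theorem one_sub_r₁_ne_zero (H : IsQRacah D q h hs s ss r₁ r₂ θ θs φ ϕ) {i : ℕ} (hi : i < D) :
    1 - r₁ * (q ^ i * q) ≠ 0 := by
  rw [← pow_succ]
  exact sub_ne_zero.2 (H.nondeg_r (i + 1) (by omega) hi).2.1.symm

theorem one_sub_r₂_ne_zero (H : IsQRacah D q h hs s ss r₁ r₂ θ θs φ ϕ) {i : ℕ} (hi : i < D) :
    1 - r₂ * (q ^ i * q) ≠ 0 := by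
  rw [← pow_succ]
  exact sub_ne_zero.2 (H.nondeg_r (i + 1) (by omega) hi).2.2.1.symm

theorem r₁_sub_ne_zero (H : IsQRacah D q h hs s ss r₁ r₂ θ θs φ ϕ) {i : ℕ} (hi : i < D) :
    r₁ - ss * (q ^ i * q) ≠ 0 := by
  rw [← pow_succ]
  intro h1
  apply (H.nondeg_r (i + 1) (by omega) hi).2.2.2.1
  rw [div_eq_one_iff_eq H.r₁_ne]
  exact (sub_eq_zero.1 h1).symm

theorem r₂_sub_ne_zero (H : IsQRacah D q h hs s ss r₁ r₂ θ θs φ ϕ) {i : ℕ} (hi : i < D) :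
    r₂ - ss * (q ^ i * q) ≠ 0 := by
  rw [← pow_succ]
  intro h1
  apply (H.nondeg_r (i + 1) (by omega) hi).2.2.2.2
  rw [div_eq_one_iff_eq H.r₂_ne]
  exact (sub_eq_zero.1 h1).symm

theorem phi_one_ne_zero (H : IsQRacah D q h hs s ss r₁ r₂ θ θs φ ϕ) (hq0 : q ≠ 0)
    (hq : ∀ n : ℕ, 0 < n → q ^ n ≠ 1) : ∀ i < D, φ (i + 1) ≠ 0 := by
  intro i hi
  rw [H.phi_one_succ hq0 hi]
  have h1 := H.h_ne
  have h2 := H.hs_ne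
  have h3 := one_sub_ne_zero hq i
  have h4 := one_sub_div_ne_zero hq0 hq hi
  have h5 := H.one_sub_r₁_ne_zero hi
  have h6 := H.one_sub_r₂_ne_zero hi
  have h7 : q ^ i ≠ 0 := pow_ne_zero i hq0
  positivity

theorem phi_two_ne_zero (H : IsQRacah D q h hs s ss r₁ r₂ θ θs φ ϕ) (hq0 : q ≠ 0)
    (hq : ∀ n : ℕ, 0 < n → q ^ n ≠ 1) : ∀ i < D, ϕ (i + 1) ≠ 0 := by
  intro i hi
  rw [H.phi_two_succ hq0 hi]
  have h1 := H.h_ne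
  have h2 := H.hs_ne
  have h3 := one_sub_ne_zero hq i
  have h4 := one_sub_div_ne_zero hq0 hq hi
  have h5 := H.r₁_sub_ne_zero hi
  have h6 := H.r₂_sub_ne_zero hi
  have h7 : q ^ i ≠ 0 := pow_ne_zero i hq0
  have h8 := H.ss_ne
  positivity

/-- Up to powers of `q`, the two factors of `θ*_{i+1} - θ*_l` are those of `θ*_i - θ*_{l-1}` and
`θ*_i - θ*_{l+1}`, so the quotient of the products telescopes. A free upper end `m` makes the
induction possible; `m = D` is the case used for `c_i`. -/
theorem prod_thetas_sub (H : IsQRacah D q h hs s ss r₁ r₂ θ θs φ ϕ) (hq0 : q ≠ 0) {i m : ℕ}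
    (him : i + 1 ≤ m) (hm : m ≤ D) :
    (∏ l ∈ Finset.Ico (i + 2) (m + 1), (θs (i + 1) - θs l)) *
        (hs * (q ^ m - q ^ i) * (1 - ss * ((q ^ i) ^ 2 * q ^ 2)) *
          (1 - ss * ((q ^ i) ^ 2 * q ^ 3))) =
      (∏ l ∈ Finset.Ico (i + 1) (m + 1), (θs i - θs l)) *
        ((q ^ i) ^ 2 * q * (1 - ss * (q ^ i * q ^ m * q ^ 2))) := by
  have h1 : q ^ i ≠ 0 := pow_ne_zero i hq0
  induction m, him using Nat.le_induction with
  | base =>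
    rw [show i + 1 + 1 = i + 2 from rfl, Finset.Ico_self, Finset.prod_empty,
      Nat.Ico_succ_singleton, Finset.prod_singleton, H.thetas_sub hq0 (by omega) hm, pow_succ]
    generalize q ^ i = Q at *
    field_simp
  | succ m him ih =>
    rw [Finset.prod_Ico_succ_top (show i + 2 ≤ m + 1 by omega),
      Finset.prod_Ico_succ_top (show i + 1 ≤ m + 1 by omega),
      H.thetas_sub hq0 (by omega) hm, H.thetas_sub hq0 (by omega) hm]
    have ih := ih (by omega)
    have h2 : q ^ m ≠ 0 := pow_ne_zero m hq0
    have h3 := H.hs_ne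
    rw [pow_succ q i, pow_succ q m]
    generalize q ^ i = Q at *
    generalize q ^ m = M at *
    generalize (∏ l ∈ Finset.Ico (i + 2) (m + 1), (θs (i + 1) - θs l)) = P at *
    generalize (∏ l ∈ Finset.Ico (i + 1) (m + 1), (θs i - θs l)) = P' at *
    field_simp
    linear_combination (M * q - Q) * (1 - ss * Q * M * q ^ 3) * ih

/-- The intersection numbers `c_i` in terms of the `q`-Racah parameters. -/
theorem c_eq (H : IsQRacah D q h hs s ss r₁ r₂ θ θs φ ϕ) (hq0 : q ≠ 0)
    (hq : ∀ n : ℕ, 0 < n → q ^ n ≠ 1) {c : ℕ → ℂ} {i : ℕ} (hi : i + 1 < D)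
    (hc : c (i + 1) * ∏ l ∈ Finset.Ico (i + 1) (D + 1), (θs i - θs l) =
      ϕ (i + 1) * ∏ l ∈ Finset.Ico (i + 2) (D + 1), (θs (i + 1) - θs l)) :
    c (i + 1) = h * (1 - q ^ i * q) * (1 - ss * (q ^ i * q ^ D * q ^ 2)) *
      (r₁ - ss * (q ^ i * q)) * (r₂ - ss * (q ^ i * q)) /
      (ss * q ^ D * (1 - ss * ((q ^ i) ^ 2 * q ^ 2)) * (1 - ss * ((q ^ i) ^ 2 * q ^ 3))) := by
  have h0 := prod_sub_ne_zero (H.thetas_injOn hq0 hq) (j := i)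
  have h1 := H.prod_thetas_sub hq0 hi.le le_rfl
  have h2 : 1 - ss * ((q ^ i) ^ 2 * q ^ 2) ≠ 0 := by
    rw [← pow_mul, ← pow_add]
    exact H.one_sub_ss_ne_zero (by omega) (by omega)
  have h3 : 1 - ss * ((q ^ i) ^ 2 * q ^ 3) ≠ 0 := by
    rw [← pow_mul, ← pow_add]
    exact H.one_sub_ss_ne_zero (by omega) (by omega)
  have h4 : q ^ D - q ^ i ≠ 0 := sub_ne_zero.2 (pow_ne_pow hq0 hq (by omega))
  have h5 : q ^ i ≠ 0 := pow_ne_zero i hq0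
  have h6 : q ^ D ≠ 0 := pow_ne_zero D hq0
  have h7 := H.hs_ne
  have h8 := H.ss_ne
  rw [H.phi_two_succ hq0 (by omega)] at hc
  generalize (∏ l ∈ Finset.Ico (i + 2) (D + 1), (θs (i + 1) - θs l)) = P at *
  generalize (∏ l ∈ Finset.Ico (i + 1) (D + 1), (θs i - θs l)) = P' at *
  generalize q ^ i = Q at *
  generalize q ^ D = N at *
  rw [eq_div_iff (by positivity)]
  field_simp at hc
  apply mul_right_cancel₀ (mul_ne_zero (mul_ne_zero (mul_ne_zero (mul_ne_zero (mul_ne_zero h0 h7) h4) hq0) h5) h5)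
  linear_combination hs * (N - Q) * (1 - ss * (Q ^ 2 * q ^ 2)) * (1 - ss * (Q ^ 2 * q ^ 3)) * hc +
    h * (1 - Q * q) * (N - Q) * (r₁ - ss * (Q * q)) * (r₂ - ss * (Q * q)) * hs * h1

/-- In the formula of `c_eq` the factor `1 - s* q^{2D+1}` would appear above and below at index `D`.
Nondegeneracy stops at exponent `2D`, so this factor may vanish and `c_D` needs the cancelled form.
-/
theorem c_last (H : IsQRacah D q h hs s ss r₁ r₂ θ θs φ ϕ) (hq0 : q ≠ 0)
    (hq : ∀ n : ℕ, 0 < n → q ^ n ≠ 1) {c : ℕ → ℂ} {i : ℕ} (hi : i + 1 = D)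
    (hc : c (i + 1) * ∏ l ∈ Finset.Ico (i + 1) (D + 1), (θs i - θs l) =
      ϕ (i + 1) * ∏ l ∈ Finset.Ico (i + 2) (D + 1), (θs (i + 1) - θs l)) :
    c (i + 1) = h * (1 - q ^ i * q) *
      (r₁ - ss * (q ^ i * q)) * (r₂ - ss * (q ^ i * q)) /
      (ss * (q ^ i * q) * (1 - ss * ((q ^ i) ^ 2 * q ^ 2))) := by
  have h2 : 1 - ss * ((q ^ i) ^ 2 * q ^ 2) ≠ 0 := by
    rw [← pow_mul, ← pow_add]
    exact H.one_sub_ss_ne_zero (by omega) (by omega)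
  have h5 : q ^ i ≠ 0 := pow_ne_zero i hq0
  have h7 := H.hs_ne
  have h8 := H.ss_ne
  have h9 : q - 1 ≠ 0 := sub_ne_zero.2 (by simpa using hq 1 one_pos)
  rw [H.phi_two_succ hq0 (by omega)] at hc
  subst hi
  rw [show i + 1 + 1 = i + 2 from rfl, Finset.Ico_self, Finset.prod_empty,
      Nat.Ico_succ_singleton, Finset.prod_singleton, H.thetas_sub hq0 (by omega) le_rfl,
      pow_succ] at hc
  generalize q ^ i = Q at *
  rw [eq_div_iff (by positivity)]
  field_simp at hc
  linear_combination hc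

/-- The intersection numbers `b_i` in terms of the `q`-Racah parameters. -/
theorem b_eq (H : IsQRacah D q h hs s ss r₁ r₂ θ θs φ ϕ) (hq0 : q ≠ 0)
    (hq : ∀ n : ℕ, 0 < n → q ^ n ≠ 1) {a b c : ℕ → ℂ} {i : ℕ} (hi : i + 1 < D)
    (hsum : c (i + 1) + a (i + 1) + b (i + 1) = θ 0)
    (ha : (a (i + 1) - θ (i + 1)) * ((θs (i + 1) - θs (i + 2)) * (θs i - θs (i + 1))) =
      φ (i + 2) * (θs i - θs (i + 1)) - φ (i + 1) * (θs (i + 1) - θs (i + 2)))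
    (hc : c (i + 1) = h * (1 - q ^ i * q) * (1 - ss * (q ^ i * q ^ D * q ^ 2)) *
      (r₁ - ss * (q ^ i * q)) * (r₂ - ss * (q ^ i * q)) /
      (ss * q ^ D * (1 - ss * ((q ^ i) ^ 2 * q ^ 2)) * (1 - ss * ((q ^ i) ^ 2 * q ^ 3)))) :
    b (i + 1) = h * (1 - q ^ i * q / q ^ D) * (1 - ss * (q ^ i * q ^ 2)) *
      (1 - r₁ * (q ^ i * q ^ 2)) * (1 - r₂ * (q ^ i * q ^ 2)) /
      ((1 - ss * ((q ^ i) ^ 2 * q ^ 3)) * (1 - ss * ((q ^ i) ^ 2 * q ^ 4))) := by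
  have h2 : 1 - ss * ((q ^ i) ^ 2 * q ^ 2) ≠ 0 := by
    rw [← pow_mul, ← pow_add]
    exact H.one_sub_ss_ne_zero (by omega) (by omega)
  have h3 : 1 - ss * ((q ^ i) ^ 2 * q ^ 3) ≠ 0 := by
    rw [← pow_mul, ← pow_add]
    exact H.one_sub_ss_ne_zero (by omega) (by omega)
  have h4 : 1 - ss * ((q ^ i) ^ 2 * q ^ 4) ≠ 0 := by
    rw [← pow_mul, ← pow_add]
    exact H.one_sub_ss_ne_zero (by omega) (by omega)
  have h5 : q ^ i ≠ 0 := pow_ne_zero i hq0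
  have h6 : q ^ D ≠ 0 := pow_ne_zero D hq0
  have h7 := H.hs_ne
  have h8 := H.ss_ne
  have h9 : q - 1 ≠ 0 := sub_ne_zero.2 (by simpa using hq 1 one_pos)
  have hb : b (i + 1) = θ 0 - c (i + 1) - a (i + 1) := by linear_combination hsum
  have hs' : s = r₁ * r₂ / (ss * (q ^ D * q)) := by
    rw [eq_div_iff (by positivity), H.r_mul, pow_succ]
    ring
  have e1 : θs (i + 1) - θs (i + 2) =
      hs * (q - 1) * (1 - ss * ((q ^ i) ^ 2 * q ^ 4)) / (q ^ i * q ^ 2) := by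
    rw [H.thetas_sub hq0 (by omega) (by omega), pow_succ, pow_succ, pow_succ]
    field_simp
  have e2 : θs i - θs (i + 1) =
      hs * (q - 1) * (1 - ss * ((q ^ i) ^ 2 * q ^ 2)) / (q ^ i * q) := by
    rw [H.thetas_sub hq0 (by omega) (by omega), pow_succ]
    field_simp
  have e3 : a (i + 1) = θ (i + 1) + φ (i + 2) / (θs (i + 1) - θs (i + 2)) -
      φ (i + 1) / (θs i - θs (i + 1)) := by
    have e4 : θs (i + 1) - θs (i + 2) ≠ 0 := by rw [e1]; positivity
    have e5 : θs i - θs (i + 1) ≠ 0 := by rw [e2]; positivity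
    field_simp
    linear_combination ha
  rw [hb, hc, e3, e1, e2, H.theta (i + 1) (by omega), H.phi_one_succ hq0 (by omega),
    H.phi_one_succ hq0 (by omega), hs', pow_succ q (i + 1), pow_succ q i]
  generalize q ^ i = Q at *
  generalize q ^ D = N at *
  clear hsum ha hb hc e3 e1 e2 hs' H hq
  -- The nonzero denominators are kept as atoms while fractions are cleared, and unfolded only for
  -- the final polynomial identity.
  obtain ⟨Y, hY⟩ : ∃ Y, Y = 1 - ss * (Q ^ 2 * q ^ 2) := ⟨_, rfl⟩
  obtain ⟨Z, hZ⟩ : ∃ Z, Z = 1 - ss * (Q ^ 2 * q ^ 3) := ⟨_, rfl⟩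
  obtain ⟨W, hW⟩ : ∃ W, W = 1 - ss * (Q ^ 2 * q ^ 4) := ⟨_, rfl⟩
  rw [← hY] at h2 ⊢
  rw [← hZ] at h3 ⊢
  rw [← hW] at h4 ⊢
  field_simp
  rw [hY, hZ, hW]
  ring

/-- Separate from `b_eq` because the general expression would carry `1 - s* q` above and below, and
this factor is not assumed nonzero. -/
theorem b_zero (H : IsQRacah D q h hs s ss r₁ r₂ θ θs φ ϕ) (hq0 : q ≠ 0)
    (hq : ∀ n : ℕ, 0 < n → q ^ n ≠ 1) {a b c : ℕ → ℂ} (hD : 0 < D)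
    (hsum : c 0 + a 0 + b 0 = θ 0) (hc : c 0 = 0)
    (ha : (a 0 - θ 0) * (θs 0 - θs 1) = φ 1) :
    b 0 = h * (1 - 1 / q ^ D) * (1 - r₁ * q) * (1 - r₂ * q) / (1 - ss * q ^ 2) := by
  have h2 : 1 - ss * q ^ 2 ≠ 0 := H.one_sub_ss_ne_zero (by omega) (by omega)
  have h7 := H.hs_ne
  have h6 : q ^ D ≠ 0 := pow_ne_zero D hq0
  have h9 : q - 1 ≠ 0 := sub_ne_zero.2 (by simpa using hq 1 one_pos)
  have e := H.thetas_sub hq0 (Nat.zero_le D) (show 1 ≤ D by omega)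
  rw [e, H.phi_one_succ (i := 0) hq0 hD] at ha
  have hb : a 0 - θ 0 = - b 0 := by linear_combination hsum - hc
  rw [hb] at ha
  simp only [pow_zero, one_mul, pow_one] at ha
  rw [eq_div_iff h2]
  have h3 : 1 - ss * (q * q) ≠ 0 := by rwa [← pow_two]
  generalize q ^ D = N at *
  field_simp at ha ⊢
  apply mul_left_cancel₀ (mul_ne_zero h7 h9)
  linear_combination -hs * ha

end IsQRacah

/-! ### Sphere sizes and the action of distance matrices on eigenspaces. -/

section Spheres

set_option linter.unusedSectionVars false

variable {X : Type*} [Fintype X] [DecidableEq X] {G : SimpleGraph X} {a b c : ℕ → ℕ}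

theorem dotProduct_distMatrix_mulVec (G : SimpleGraph X) (i : ℕ) (u v : X → ℂ) :
    u ⬝ᵥ (distMatrix G i *ᵥ v) = v ⬝ᵥ (distMatrix G i *ᵥ u) := by
  have h : (distMatrix G i)ᵀ = distMatrix G i := by
    ext y z
    simp [distMatrix, SimpleGraph.dist_comm]
  rw [dotProduct_mulVec, ← mulVec_transpose, h, dotProduct_comm]

theorem kNum_succ (b c : ℕ → ℕ) (i : ℕ) : kNum b c (i + 1) = kNum b c i * b i / c (i + 1) := by
  rw [kNum, kNum, Finset.prod_range_succ, Finset.prod_range_succ]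
  rw [mul_div_mul_comm, mul_div_assoc]

theorem IsDistanceRegular.kNum_ne_zero (hG : IsDistanceRegular G a b c) {i : ℕ}
    (hi : i ≤ G.diam) : kNum b c i ≠ 0 := by
  refine div_ne_zero ?_ ?_ <;> refine Finset.prod_ne_zero_iff.2 fun j hj => ?_
  · exact_mod_cast hG.b_ne_zero (by have := Finset.mem_range.1 hj; omega)
  · exact_mod_cast hG.c_ne_zero (by have := Finset.mem_range.1 hj; omega)

/-- Edges between the spheres of radii `i` and `i + 1` are counted from both sides, by pairing the
two indicator vectors through the symmetric matrix `A`. -/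
theorem IsDistanceRegular.sphere_ncard (hG : IsDistanceRegular G a b c) (z : X) {i : ℕ}
    (hi : i ≤ G.diam) : ({y | G.dist z y = i}.ncard : ℂ) = kNum b c i := by
  induction i with
  | zero =>
    have h : {y | G.dist z y = 0} = {z} := by
      ext y
      simp [hG.connected.dist_eq_zero_iff, eq_comm]
    rw [h]
    simp [kNum]
  | succ i ih =>
    have hc : (c (i + 1) : ℂ) ≠ 0 := by exact_mod_cast hG.c_ne_zero hi
    rw [kNum_succ, ← ih (by omega), eq_div_iff hc]
    have h := dotProduct_distMatrix_mulVec G 1 (fun y => if G.dist z y = i + 1 then 1 else 0)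
      (fun y => if G.dist z y = i then 1 else 0)
    simp only [dotProduct, ite_mul, one_mul, zero_mul] at h
    rw [← sum_ite_eq_ncard, ← sum_ite_eq_ncard]
    refine Eq.trans (Finset.sum_congr rfl fun y _ => ?_)
      (h.trans (Finset.sum_congr rfl fun y _ => ?_))
    · split_ifs with h1
      · rw [hG.mulVec_radial z y fun j => if j = i then 1 else 0]
        have h2 : i + 1 + 1 ≠ i := by omega
        simp [h1, h2]
      · rfl
    · split_ifs with h1
      · rw [hG.mulVec_radial z y fun j => if j = i + 1 then 1 else 0]
        have h2 : i - 1 ≠ i + 1 := by omega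
        simp [h1, h2]
      · rfl

/-- By `A A_j = c_{j+1} A_{j+1} + a_j A_j + b_{j-1} A_{j-1}` with `c_{j+1} ≠ 0`, each `A_j` is a
polynomial in `A`. The scalar `m` therefore depends on `τ` only, not on the eigenvector. -/
theorem IsDistanceRegular.distMatrix_mulVec_eigenvector (hG : IsDistanceRegular G a b c)
    (τ : ℂ) {j : ℕ} (hj : j ≤ G.diam) :
    ∃ m : ℂ, ∀ v : X → ℂ, distMatrix G 1 *ᵥ v = τ • v → distMatrix G j *ᵥ v = m • v := by
  have key : ∀ j, ∀ v : X → ℂ, distMatrix G 1 *ᵥ v = τ • v →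
      (c (j + 1) : ℂ) • (distMatrix G (j + 1) *ᵥ v) + (a j : ℂ) • (distMatrix G j *ᵥ v) +
        (if j = 0 then 0 else (b (j - 1) : ℂ) • (distMatrix G (j - 1) *ᵥ v)) =
      τ • (distMatrix G j *ᵥ v) := by
    intro j v hv
    ext y
    have h1 : (τ • (distMatrix G j *ᵥ v)) y =
        (distMatrix G 1 *ᵥ v) ⬝ᵥ (fun z => if G.dist y z = j then 1 else 0) := by
      rw [hv, dotProduct_comm]
      simp only [distMatrix, mulVec, of_apply, Pi.smul_apply, dotProduct_smul]
    rw [h1, dotProduct_comm, dotProduct_distMatrix_mulVec]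
    simp only [Pi.add_apply, Pi.smul_apply, smul_eq_mul]
    have h2 : (if j = 0 then 0 else (b (j - 1) : ℂ) • (distMatrix G (j - 1) *ᵥ v)) y =
        if j = 0 then 0 else (b (j - 1) : ℂ) * (distMatrix G (j - 1) *ᵥ v) y := by
      split_ifs <;> rfl
    rw [h2]
    have h3 : ∀ z, (distMatrix G 1 *ᵥ fun z => if G.dist y z = j then 1 else 0) z =
        c (j + 1) * (if G.dist y z = j + 1 then 1 else 0) +
          a j * (if G.dist y z = j then 1 else 0) +
          (if j = 0 then 0 else (b (j - 1) : ℂ) * (if G.dist y z = j - 1 then 1 else 0)) := by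
      intro z
      rw [hG.mulVec_radial y z fun i => if i = j then 1 else 0]
      generalize G.dist y z = n
      have h4 := hG.c_zero
      rcases j with _ | j
      · rcases n with _ | _ | n <;> simp [h4]
      · by_cases h5 : n = j + 1 + 1
        · subst h5
          have h9 : j + 1 + 1 ≠ j := by omega
          simp [h9]
        by_cases h6 : n = j + 1
        · subst h6; simp
        by_cases h7 : n = j
        · subst h7
          have h8 : n - 1 ≠ n + 1 := by omega
          have h9 : n ≠ n + 1 + 1 := by omega
          simp [h8, h9]
        have h8 : n - 1 ≠ j + 1 := by omega
        simp [h5, h6, h7, h8]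
    simp only [dotProduct, h3, mul_add, Finset.sum_add_distrib]
    congr 1
    · congr 1
      · rw [distMatrix, mulVec, dotProduct, Finset.mul_sum]
        refine Finset.sum_congr rfl fun z _ => ?_
        rw [of_apply]
        ring
      · rw [distMatrix, mulVec, dotProduct, Finset.mul_sum]
        refine Finset.sum_congr rfl fun z _ => ?_
        rw [of_apply]
        ring
    · split_ifs
      · simp
      · rw [distMatrix, mulVec, dotProduct, Finset.mul_sum]
        refine Finset.sum_congr rfl fun z _ => ?_
        rw [of_apply]
        ring
  induction j using Nat.strong_induction_on with
  | _ j ih =>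
    rcases j with _ | j
    · refine ⟨1, fun v _ => ?_⟩
      have h : distMatrix G 0 = 1 := by
        ext y z
        simp [distMatrix, hG.connected.dist_eq_zero_iff, one_apply]
      rw [h, one_mulVec, one_smul]
    · have hc : (c (j + 1) : ℂ) ≠ 0 := by exact_mod_cast hG.c_ne_zero hj
      obtain ⟨m, hm⟩ := ih j (by omega) (by omega)
      by_cases hj0 : j = 0
      · refine ⟨(τ - a j) * m / c (j + 1), fun v hv => ?_⟩
        have h1 := key j v hv
        rw [if_pos hj0, add_zero, hm v hv, smul_smul, smul_smul, ← eq_sub_iff_add_eq,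
          ← sub_smul] at h1
        rw [div_eq_inv_mul, ← smul_smul, eq_inv_smul_iff₀ hc, h1, sub_mul]
      · obtain ⟨m', hm'⟩ := ih (j - 1) (by omega) (by omega)
        refine ⟨((τ - a j) * m - b (j - 1) * m') / c (j + 1), fun v hv => ?_⟩
        have h1 := key j v hv
        rw [if_neg hj0, hm v hv, hm' v hv, smul_smul, smul_smul, smul_smul, add_assoc,
          ← eq_sub_iff_add_eq, ← add_smul, ← sub_smul] at h1
        rw [div_eq_inv_mul, ← smul_smul, eq_inv_smul_iff₀ hc, h1]
        congr 1
        ring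

end Spheres

/-! ### Orthogonality of a Delsarte clique to an eigenspace. -/

section Delsarte

variable {X : Type*} [Fintype X] [DecidableEq X] {G : SimpleGraph X} {a b c : ℕ → ℕ}

open scoped ComplexOrder in
/-- The characteristic vector of a Delsarte clique is orthogonal to the eigenspace of the least
eigenvalue `τ`; here `γ` is proportional to the sequence of cosines of `τ`. -/
theorem IsDistanceRegular.sum_clique_eq_zero (hG : IsDistanceRegular G a b c) {τ : ℝ}
    (hτ : τ ≠ 0) {γ : ℕ → ℂ}
    (hγ : ∀ j ≤ G.diam, c j * γ (j - 1) + a j * γ j + b j * γ (j + 1) = (τ : ℂ) * γ j)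
    {K : Finset X} (hK : G.IsClique (K : Set X)) (hcard : (K.card : ℝ) = 1 - b 0 / τ)
    (y : X) : ∑ z ∈ K, γ (G.dist z y) = 0 := by
  -- `F = ∑ γ_j A_j` plays the role of the projection to the eigenspace of `τ`: `A F = τ F`, and `F`
  -- is a scalar on that eigenspace. Hence the squared norm of `F χ` is a multiple of `χᵀ F χ`,
  -- which vanishes by the size of the clique.
  set F : Matrix X X ℂ := of fun y z => γ (G.dist z y) with hF
  set χ : X → ℂ := fun z => if z ∈ K then 1 else 0 with hχ
  have hFχ : ∀ y, (F *ᵥ χ) y = ∑ z ∈ K, γ (G.dist z y) := by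
    intro y
    simp [hF, hχ, mulVec, dotProduct]
  have hAF : distMatrix G 1 * F = (τ : ℂ) • F := by
    ext y z
    have h1 := hG.mulVec_radial z y γ
    rw [hγ _ (hG.dist_le z y)] at h1
    exact h1
  have hA : distMatrix G 1 *ᵥ (F *ᵥ χ) = (τ : ℂ) • (F *ᵥ χ) := by
    rw [mulVec_mulVec, hAF, smul_mulVec]
  -- `γ` may be complex, so `F` need not be Hermitian; but `A` and `τ` are real, and conjugation
  -- preserves the eigenspace.
  have hA' : distMatrix G 1 *ᵥ star (F *ᵥ χ) = (τ : ℂ) • star (F *ᵥ χ) := by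
    have h1 := congrArg star hA
    rw [star_smul, Complex.star_def, Complex.conj_ofReal] at h1
    rw [← h1]
    ext y
    simp only [distMatrix_one_mulVec, Pi.star_apply, star_sum, apply_ite star, star_zero]
  have hsymm : Fᵀ = F := by
    ext y z
    simp [hF, SimpleGraph.dist_comm]
  have hFm : F = ∑ j ∈ Finset.range (G.diam + 1), γ j • distMatrix G j := by
    ext y z
    rw [Matrix.sum_apply]
    simp only [hF, of_apply, Matrix.smul_apply, distMatrix, smul_eq_mul, mul_ite, mul_one,
      mul_zero]
    rw [Finset.sum_ite_eq, if_pos, SimpleGraph.dist_comm]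
    exact Finset.mem_range.2 (Nat.lt_succ_of_le (hG.dist_le y z))
  obtain ⟨m, hm⟩ : ∃ m : ℂ, F *ᵥ star (F *ᵥ χ) = m • star (F *ᵥ χ) := by
    have h1 : ∀ j, ∃ m : ℂ, j ≤ G.diam →
        distMatrix G j *ᵥ star (F *ᵥ χ) = m • star (F *ᵥ χ) := by
      intro j
      by_cases hj : j ≤ G.diam
      · obtain ⟨m, hm⟩ := hG.distMatrix_mulVec_eigenvector (τ : ℂ) hj
        exact ⟨m, fun _ => hm _ hA'⟩
      · exact ⟨0, fun h => absurd h hj⟩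
    choose m hm using h1
    refine ⟨∑ j ∈ Finset.range (G.diam + 1), γ j * m j, ?_⟩
    have h2 : ∀ v : X → ℂ, F *ᵥ v =
        ∑ j ∈ Finset.range (G.diam + 1), γ j • (distMatrix G j *ᵥ v) := by
      intro v
      conv_lhs => rw [hFm]
      rw [sum_mulVec]
      exact Finset.sum_congr rfl fun j _ => smul_mulVec _ _ _
    rw [h2, Finset.sum_smul]
    refine Finset.sum_congr rfl fun j hj => ?_
    rw [hm j (by have := Finset.mem_range.1 hj; omega), smul_smul]
  -- On the clique `F` has `γ 0` on the diagonal and `γ 1` elsewhere. Each row sum is `γ 0 + (|K| -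
  -- 1) γ 1`, which is zero since `b_0 γ 1 = τ γ 0` and `|K| - 1 = -b_0/τ`.
  have hquad : χ ⬝ᵥ (F *ᵥ χ) = 0 := by
    have h0 : (b 0 : ℂ) * γ 1 = τ * γ 0 := by
      have h1 := hγ 0 (Nat.zero_le _)
      rw [hG.c_zero, hG.a_zero] at h1
      simpa using h1
    have h1 : ∀ y ∈ K, (F *ᵥ χ) y = γ 0 + (K.card - 1) * γ 1 := by
      intro y hy
      rw [hFχ, ← Finset.add_sum_erase K _ hy, SimpleGraph.dist_self]
      congr 1
      have h2 : ∀ z ∈ K.erase y, γ (G.dist z y) = γ 1 := by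
        intro z hz
        rw [SimpleGraph.dist_eq_one_iff_adj.2
          (hK (Finset.mem_of_mem_erase hz) hy (Finset.ne_of_mem_erase hz))]
      rw [Finset.sum_congr rfl h2, Finset.sum_const, nsmul_eq_mul, Finset.card_erase_of_mem hy,
        Nat.cast_sub (Finset.card_pos.2 ⟨y, hy⟩), Nat.cast_one]
    have h3 : γ 0 + ((K.card : ℂ) - 1) * γ 1 = 0 := by
      have h4 : (K.card : ℂ) = 1 - b 0 / τ := by exact_mod_cast congrArg (Complex.ofReal) hcard
      have h5 : (τ : ℂ) ≠ 0 := by exact_mod_cast hτ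
      rw [h4]
      field_simp
      linear_combination -h0
    simp only [dotProduct, hχ, ite_mul, one_mul, zero_mul]
    rw [Finset.sum_ite_mem, Finset.univ_inter]
    refine Finset.sum_eq_zero fun y hy => ?_
    rw [h1 y hy, h3]
  have hstar : star χ = χ := by
    ext y
    simp [hχ, apply_ite]
  have hzero : star (F *ᵥ χ) ⬝ᵥ (F *ᵥ χ) = 0 := by
    rw [dotProduct_mulVec, ← mulVec_transpose, hsymm, hm, smul_dotProduct]
    have h1 := congrArg star hquad
    rw [star_zero, ← star_dotProduct_star, hstar, dotProduct_comm] at h1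
    rw [dotProduct_comm, h1, smul_zero]
  rw [← hFχ, dotProduct_star_self_eq_zero.1 hzero]
  rfl

end Delsarte

/-! ### Sizes of the cells cut out by a clique and one of its vertices. -/

section Cells

set_option linter.unusedSectionVars false

variable {X : Type*} [Fintype X] [DecidableEq X] {G : SimpleGraph X} {a b c : ℕ → ℕ}
  {K : Finset X}

theorem distToSet_le {y z : X} (hz : z ∈ K) : distToSet G y K ≤ G.dist z y :=
  Nat.sInf_le ⟨z, hz, SimpleGraph.dist_comm⟩

theorem exists_dist_eq_distToSet (hK : K.Nonempty) (y : X) :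
    ∃ z ∈ K, G.dist z y = distToSet G y K := by
  obtain ⟨z, hz, hz'⟩ := Nat.sInf_mem (s := G.dist y '' (K : Set X)) (hK.to_set.image _)
  exact ⟨z, hz, by rw [SimpleGraph.dist_comm]; exact hz'⟩

theorem dist_le_distToSet_add_one (hG : G.Connected) (hK : G.IsClique (K : Set X)) {y z : X}
    (hz : z ∈ K) : G.dist z y ≤ distToSet G y K + 1 := by
  obtain ⟨w, hw, hw'⟩ := exists_dist_eq_distToSet (G := G) ⟨z, hz⟩ y
  have h1 := hG.dist_triangle (u := z) (v := w) (w := y)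
  have h2 : G.dist z w ≤ 1 := by
    by_cases h : z = w
    · simp [h]
    · exact (SimpleGraph.dist_eq_one_iff_adj.2 (hK hz hw h)).le
  omega

/-- The sizes of the cells `C_i⁻` and `C_i⁺` are determined by the vanishing of the sums of the
cosines over the clique. -/
theorem IsDistanceRegular.cell_ncard (hG : IsDistanceRegular G a b c)
    (hK : G.IsClique (K : Set X)) {γ : ℕ → ℂ} (hγ : ∀ y, ∑ z ∈ K, γ (G.dist z y) = 0) {N : ℕ}
    (hN : N ≤ G.diam) (hγ0 : ∀ i < N, γ (i + 1) ≠ 0) {m p : ℕ → ℂ} (hm0 : m 0 = 1)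
    (hmp : ∀ i < N, m i * γ i + p i * γ (i + 1) = 0)
    (hpm : ∀ i < N, p i + m (i + 1) = kNum b c (i + 1)) {i : ℕ} (hi : i ≤ N) :
    (∀ z ∈ K, ((cellMinus G z K i).ncard : ℂ) = m i) ∧
      (i < N → ∀ z ∈ K, ((cellPlus G z K i).ncard : ℂ) = p i) := by
  classical
  have step : ∀ i, (∀ z ∈ K, ((cellMinus G z K i).ncard : ℂ) = m i) → i < N →
      ∀ z ∈ K, ((cellPlus G z K i).ncard : ℂ) = p i := by
    intro i hi hiN
    have hdisj : ∀ z ∈ K, ∀ y (s t : ℂ), (if distToSet G y K = i then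
        (if G.dist z y = i then s else t) else 0) =
        (if G.dist z y = i ∧ distToSet G y K = i then s else 0) +
          (if G.dist z y = i + 1 ∧ distToSet G y K = i then t else 0) := by
      intro z hz y s t
      have h1 := distToSet_le (G := G) (y := y) hz
      have h2 := dist_le_distToSet_add_one hG.connected hK (y := y) hz
      by_cases h3 : distToSet G y K = i
      · by_cases h4 : G.dist z y = i
        · simp [h3, h4]
        · have h5 : G.dist z y = i + 1 := by omega
          simp [h3, h5]
      · simp [h3]
    have hsum : ∀ z ∈ K, ∀ s t : ℂ,
        (∑ y, if distToSet G y K = i then (if G.dist z y = i then s else t) else 0) =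
          ((cellMinus G z K i).ncard : ℂ) * s + ((cellPlus G z K i).ncard : ℂ) * t := by
      intro z hz s t
      rw [cellMinus, cellPlus, ← sum_ite_eq_ncard, ← sum_ite_eq_ncard, ← Finset.sum_add_distrib]
      exact Finset.sum_congr rfl fun y _ => hdisj z hz y s t
    -- `T` counts the vertices at distance `i` from `K` and does not depend on `z`. Thus, if
    -- `|C_i⁻|` is the same for all `z ∈ K`, so is `|C_i⁺|`.
    set T : ℂ := ∑ y, if distToSet G y K = i then 1 else 0 with hT
    have hplus : ∀ z ∈ K, ((cellPlus G z K i).ncard : ℂ) = T - m i := by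
      intro z hz
      have h1 := hsum z hz 1 1
      rw [hi z hz] at h1
      simp only [ite_self] at h1
      rw [hT, h1]
      ring
    -- Summing `hγ` over all vertices at distance `i` from `K` and exchanging the sums gives `|K|
    -- (m_i γ_i + (T - m_i) γ_{i+1}) = 0`, which determines `T - m_i`.
    have htot : ∑ z ∈ K, (((cellMinus G z K i).ncard : ℂ) * γ i +
        ((cellPlus G z K i).ncard : ℂ) * γ (i + 1)) = 0 := by
      rw [← Finset.sum_congr rfl fun z hz => hsum z hz (γ i) (γ (i + 1)), Finset.sum_comm]
      refine Finset.sum_eq_zero fun y _ => ?_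
      by_cases h3 : distToSet G y K = i
      · simp only [h3, if_true]
        rw [← hγ y]
        refine Finset.sum_congr rfl fun z hz => ?_
        have h1 := distToSet_le (G := G) (y := y) hz
        have h2 := dist_le_distToSet_add_one hG.connected hK (y := y) hz
        split_ifs with h4
        · rw [h4]
        · rw [show G.dist z y = i + 1 by omega]
      · simp [h3]
    intro z hz
    have h5 : (K.card : ℂ) ≠ 0 := by
      exact_mod_cast (Finset.card_pos.2 ⟨z, hz⟩).ne'
    rw [Finset.sum_congr rfl fun z hz => by rw [hi z hz, hplus z hz], Finset.sum_const,
      nsmul_eq_mul] at htot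
    have h6 := (mul_eq_zero.1 htot).resolve_left h5
    rw [hplus z hz]
    apply mul_right_cancel₀ (hγ0 i hiN)
    linear_combination h6 - hmp i hiN
  -- The recursion alternates: `C_0⁻ = {z}`, `step` passes from `C_i⁻` to `C_i⁺`, and `C_{i+1}⁻` is
  -- what `C_i⁺` leaves of the sphere of radius `i + 1` about `z`.
  have main : ∀ i ≤ N, ∀ z ∈ K, ((cellMinus G z K i).ncard : ℂ) = m i := by
    intro i
    induction i with
    | zero =>
      intro _ z hz
      have h : cellMinus G z K 0 = {z} := by
        ext y
        simp only [cellMinus, Set.mem_ofPred_eq, Set.mem_singleton_iff,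
          hG.connected.dist_eq_zero_iff]
        constructor
        · exact fun h => h.1.symm
        · rintro rfl
          refine ⟨rfl, ?_⟩
          have := distToSet_le (G := G) (y := y) hz
          rw [SimpleGraph.dist_self] at this
          omega
      rw [h, hm0]
      simp
    | succ i ih =>
      intro hi z hz
      have h1 := step i (ih (by omega)) hi z hz
      have h2 : ((cellPlus G z K i).ncard : ℂ) + (cellMinus G z K (i + 1)).ncard =
          kNum b c (i + 1) := by
        rw [← hG.sphere_ncard z (show i + 1 ≤ G.diam by omega), ← Nat.cast_add,
          ← Set.ncard_union_eq]
        · congr 2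
          ext y
          simp only [cellPlus, cellMinus, Set.mem_union, Set.mem_ofPred_eq]
          have h1 := distToSet_le (G := G) (y := y) hz
          have h2 := dist_le_distToSet_add_one hG.connected hK (y := y) hz
          omega
        · rw [Set.disjoint_left]
          intro y hy hy'
          have := hy.2
          have := hy'.2
          omega
      linear_combination h2 - h1 - hpm i hi
  exact ⟨main i hi, fun h => step i (main i hi) h⟩

end Cells

/-! ### The vectors `v_i^⊥` and the scalars `k_i^⊥` from cell sizes. -/

section Perp

set_option linter.unusedSectionVars false

variable {X : Type*} [Fintype X] [DecidableEq X] {G : SimpleGraph X} {a b c : ℕ → ℕ}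
  {K : Finset X} {x : X}

/-- The vector `Ĉ_i⁺ + e Ĉ_{i+1}⁻`. -/
noncomputable def cellVec (G : SimpleGraph X) (x : X) (K : Finset X) (e : ℂ) (i : ℕ) : X → ℂ :=
  charVec (cellPlus G x K i) + e • charVec (cellMinus G x K (i + 1))

theorem vPerp_eq_smul_cellVec (G : SimpleGraph X) (x : X) (K : Finset X) (D : ℕ) (q ss : ℂ)
    (i : ℕ) : vPerp G x K D q ss i =
      xi D q ss (i + 1) • cellVec G x K (eps D q ss (i + 1)) i := by
  rw [vPerp, cellVec, smul_add, smul_smul]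

theorem charVec_apply (S : Set X) [DecidablePred (· ∈ S)] (y : X) :
    charVec S y = if y ∈ S then 1 else 0 := by
  rw [charVec, Set.indicator_apply]
  rfl

theorem sum_charVec (S : Set X) : ∑ y, charVec S y = (S.ncard : ℂ) := by
  classical
  simp only [charVec_apply]
  rw [sum_ite_eq_ncard, mul_one]
  rfl

theorem star_charVec (S : Set X) : star (charVec S) = charVec S := by
  classical
  ext y
  rw [Pi.star_apply, charVec_apply]
  split_ifs <;> simp

theorem charVec_mul_self (S : Set X) (y : X) : charVec S y * charVec S y = charVec S y := by
  classical
  rw [charVec_apply]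
  split_ifs <;> simp

theorem charVec_plus_mul_minus (i : ℕ) (y : X) :
    charVec (cellPlus G x K i) y * charVec (cellMinus G x K (i + 1)) y = 0 := by
  classical
  rw [charVec_apply, charVec_apply]
  split_ifs with h1 h2
  · have := h1.2
    have := h2.2
    omega
  all_goals simp

theorem star_cellVec {e : ℂ} (he : star e = e) (i : ℕ) :
    star (cellVec G x K e i) = cellVec G x K e i := by
  rw [cellVec, star_add, star_smul, he, star_charVec, star_charVec]

theorem cellVec_dotProduct_self (e : ℂ) (i : ℕ) :
    cellVec G x K e i ⬝ᵥ cellVec G x K e i =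
      (cellPlus G x K i).ncard + e ^ 2 * (cellMinus G x K (i + 1)).ncard := by
  rw [← sum_charVec, ← sum_charVec, Finset.mul_sum, ← Finset.sum_add_distrib]
  refine Finset.sum_congr rfl fun y _ => ?_
  simp only [cellVec, Pi.add_apply, Pi.smul_apply, smul_eq_mul]
  linear_combination charVec_mul_self (cellPlus G x K i) y +
    e ^ 2 * charVec_mul_self (cellMinus G x K (i + 1)) y +
    2 * e * charVec_plus_mul_minus (G := G) (x := x) (K := K) i y

theorem sum_cellVec (e : ℂ) (i : ℕ) :
    ∑ y, cellVec G x K e i y =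
      (cellPlus G x K i).ncard + e * (cellMinus G x K (i + 1)).ncard := by
  rw [← sum_charVec, ← sum_charVec, Finset.mul_sum, ← Finset.sum_add_distrib]
  rfl

theorem cellVec_one (hG : G.Connected) (hK : G.IsClique (K : Set X)) (hx : x ∈ K) (i : ℕ) :
    cellVec G x K 1 i = fun y => if G.dist x y = i + 1 then 1 else 0 := by
  classical
  ext y
  simp only [cellVec, Pi.add_apply, Pi.smul_apply, smul_eq_mul, one_mul, charVec_apply]
  have h1 := distToSet_le (G := G) (y := y) hx
  have h2 := dist_le_distToSet_add_one hG hK (y := y) hx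
  simp only [cellPlus, cellMinus, Set.mem_ofPred_eq]
  by_cases h3 : G.dist x y = i + 1
  · by_cases h4 : distToSet G y K = i
    · simp [h3, h4]
    · have h5 : distToSet G y K = i + 1 := by omega
      simp [h3, h5]
  · simp [h3]

theorem cellVec_eq_zero {e : ℂ} {i : ℕ} {y : X} (hy : G.dist x y ≠ i + 1) :
    cellVec G x K e i y = 0 := by
  classical
  simp only [cellVec, Pi.add_apply, Pi.smul_apply, smul_eq_mul, charVec_apply]
  simp [cellPlus, cellMinus, hy]

theorem charVec_dotProduct_distMatrix_mulVec (S T : Set X) :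
    charVec S ⬝ᵥ (distMatrix G 1 *ᵥ charVec T) =
      ({p : X × X | p.1 ∈ S ∧ p.2 ∈ T ∧ G.Adj p.1 p.2}.ncard : ℂ) := by
  classical
  rw [← mul_one (Set.ncard _ : ℂ), ← sum_ite_eq_ncard, Fintype.sum_prod_type]
  refine Finset.sum_congr rfl fun y _ => ?_
  rw [distMatrix_one_mulVec, Finset.mul_sum]
  refine Finset.sum_congr rfl fun z _ => ?_
  simp only [charVec_apply, SimpleGraph.dist_eq_one_iff_adj]
  by_cases h1 : y ∈ S <;> by_cases h2 : z ∈ T <;> by_cases h3 : G.Adj y z <;> simp [h1, h2, h3]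

theorem distToSet_le_add_one (hG : G.Connected) (hK : K.Nonempty) {y z : X} (h : G.Adj y z) :
    distToSet G z K ≤ distToSet G y K + 1 := by
  obtain ⟨w, hw, hw'⟩ := exists_dist_eq_distToSet (G := G) hK y
  have h1 := hG.dist_triangle (u := w) (v := y) (w := z)
  have h2 := distToSet_le (G := G) (y := z) hw
  rw [SimpleGraph.dist_eq_one_iff_adj.2 h] at h1
  omega

/-- The neighbour is the next vertex on a geodesic from `z` to a nearest vertex of the clique; the
distances to `K` and to `x` leave no other cell for it. -/
theorem exists_adj_cellPlus (hG : G.Connected) (hK : G.IsClique (K : Set X)) (hx : x ∈ K) {i : ℕ}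
    {z : X} (hz : z ∈ cellPlus G x K (i + 1)) : ∃ y ∈ cellPlus G x K i, G.Adj y z := by
  obtain ⟨h1, h2⟩ := hz
  obtain ⟨w, hw, hw'⟩ := exists_dist_eq_distToSet (G := G) ⟨x, hx⟩ z
  obtain ⟨y, hy, hy'⟩ := exists_adj_dist_eq hG (hw'.trans h2)
  have h3 := distToSet_le (G := G) (y := y) hw
  have h4 := distToSet_le_add_one hG ⟨x, hx⟩ hy
  have h5 := dist_le_distToSet_add_one hG hK (y := y) hx
  have h6 := hy.diff_dist_adj (u := x)
  refine ⟨y, ⟨?_, ?_⟩, hy⟩ <;> omega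

/-- The inner product of `A w_{i+1}` with `w_i` is a multiple of the number of edges between
`C_i⁺` and `C_{i+1}⁺`. -/
theorem IsDistanceRegular.cellVec_dotProduct (hG : IsDistanceRegular G a b c)
    (hK : G.IsClique (K : Set X)) (hx : x ∈ K) (e e' : ℂ) (i : ℕ)
    (he' : ((cellPlus G x K (i + 1)).ncard : ℂ) + e' * (cellMinus G x K (i + 2)).ncard = 0) :
    cellVec G x K e i ⬝ᵥ (distMatrix G 1 *ᵥ cellVec G x K e' (i + 1)) =
      (1 - e) * (charVec (cellPlus G x K i) ⬝ᵥ
        (distMatrix G 1 *ᵥ charVec (cellPlus G x K (i + 1)))) := by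
  have h1 : cellVec G x K e i =
      (1 - e) • charVec (cellPlus G x K i) + e • cellVec G x K 1 i := by
    rw [cellVec, cellVec, one_smul, smul_add, sub_smul, one_smul]
    abel
  -- With `e = 1` the vector is the indicator of a whole sphere. Its image under `A` is constant on
  -- the sphere of radius `i + 2`, where the other vector has coordinate sum zero by `he'`.
  have h2 : cellVec G x K 1 i ⬝ᵥ (distMatrix G 1 *ᵥ cellVec G x K e' (i + 1)) = 0 := by
    rw [dotProduct_distMatrix_mulVec, cellVec_one hG.connected hK hx]
    have h3 : ∀ y, cellVec G x K e' (i + 1) y *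
        (distMatrix G 1 *ᵥ fun y => if G.dist x y = i + 1 then 1 else 0) y =
        cellVec G x K e' (i + 1) y * c (i + 2) := by
      intro y
      by_cases hy : G.dist x y = i + 2
      · rw [hG.mulVec_radial x y fun j => if j = i + 1 then 1 else 0]
        have h4 : i + 2 + 1 ≠ i + 1 := by omega
        simp [hy]
      · rw [cellVec_eq_zero hy, zero_mul, zero_mul]
    rw [dotProduct, Finset.sum_congr rfl fun y _ => h3 y, ← Finset.sum_mul, sum_cellVec, he',
      zero_mul]
  -- These two cells are at distances `i` and `i + 2` from `K`, so no edge joins them.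
  have h3 : charVec (cellPlus G x K i) ⬝ᵥ
      (distMatrix G 1 *ᵥ charVec (cellMinus G x K (i + 1 + 1))) = 0 := by
    rw [charVec_dotProduct_distMatrix_mulVec]
    norm_cast
    rw [Set.ncard_eq_zero]
    ext ⟨y, z⟩
    simp only [Set.mem_ofPred_eq, Set.mem_empty_iff_false, iff_false]
    rintro ⟨hy, hz, hyz⟩
    have := distToSet_le_add_one hG.connected ⟨x, hx⟩ hyz
    have := hy.2
    have := hz.2
    omega
  rw [h1, add_dotProduct, smul_dotProduct, smul_dotProduct, h2, cellVec, mulVec_add,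
    dotProduct_add, mulVec_smul, dotProduct_smul, h3]
  simp

/-- The conjugate of `s` cancels between numerator and denominator, so the factors `ξ_i` need not be
real. -/
theorem coordAlong_smul {s t : ℂ} {v w : X → ℂ} (hs : s ≠ 0) (hv : star v = v) :
    coordAlong (s • v) (distMatrix G 1 *ᵥ (t • w)) =
      t / s * ((v ⬝ᵥ (distMatrix G 1 *ᵥ w)) / (v ⬝ᵥ v)) := by
  have hs' : star s ≠ 0 := star_ne_zero.2 hs
  rw [coordAlong, star_smul, hv, mulVec_smul, smul_dotProduct, smul_dotProduct, dotProduct_smul,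
    dotProduct_smul]
  simp only [smul_eq_mul]
  rw [mul_div_mul_left _ _ hs', mul_div_mul_comm]

/-- By symmetry of `A` the same inner product occurs in `b_i^⊥` and `c_{i+1}^⊥`. It cancels once
known to be nonzero, and the remaining ratios of squared lengths telescope. -/
theorem IsDistanceRegular.kPerp_eq (hG : IsDistanceRegular G a b c)
    (hK : G.IsClique (K : Set X)) (hx : x ∈ K) {D : ℕ} {q ss : ℂ} {N : ℕ}
    (hxi : ∀ i < N, xi D q ss (i + 1) ≠ 0) (heps : ∀ i < N, 1 - eps D q ss (i + 1) ≠ 0)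
    (hp : ∀ i < N, ((cellPlus G x K i).ncard : ℂ) ≠ 0)
    (he : ∀ i < N, ((cellPlus G x K i).ncard : ℂ) +
      eps D q ss (i + 1) * (cellMinus G x K (i + 1)).ncard = 0) {i : ℕ} (hi : i < N) :
    kPerp G x K D q ss i = (xi D q ss (i + 1) / xi D q ss 1) ^ 2 *
      ((cellPlus G x K i).ncard * (1 - eps D q ss (i + 1)) /
        ((cellPlus G x K 0).ncard * (1 - eps D q ss 1))) := by
  have hm : ∀ i < N, ((cellMinus G x K (i + 1)).ncard : ℂ) ≠ 0 := by
    intro i hi h0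
    have h1 := he i hi
    rw [h0, mul_zero, add_zero] at h1
    exact hp i hi h1
  -- `ϵ_{i+1}` is a quotient of cell sizes up to sign, hence real, although `q` and `s*` may be
  -- complex.
  have hstar : ∀ i < N, star (eps D q ss (i + 1)) = eps D q ss (i + 1) := by
    intro i hi
    have h1 : eps D q ss (i + 1) =
        -((cellPlus G x K i).ncard : ℂ) / (cellMinus G x K (i + 1)).ncard := by
      rw [eq_div_iff (hm i hi)]
      linear_combination he i hi
    rw [h1]
    simp
  set w : ℕ → X → ℂ := fun i => cellVec G x K (eps D q ss (i + 1)) i with hw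
  have hwstar : ∀ i < N, star (w i) = w i := fun i hi => star_cellVec (hstar i hi) i
  have hnorm : ∀ i < N, w i ⬝ᵥ w i =
      (cellPlus G x K i).ncard * (1 - eps D q ss (i + 1)) := by
    intro i hi
    rw [hw, cellVec_dotProduct_self]
    linear_combination eps D q ss (i + 1) * he i hi
  have hnorm0 : ∀ i < N, w i ⬝ᵥ w i ≠ 0 := by
    intro i hi
    rw [hnorm i hi]
    exact mul_ne_zero (hp i hi) (heps i hi)
  -- The inner product is a nonzero multiple of the number of edges between `C_i⁺` and `C_{i+1}⁺`,
  -- and such an edge exists.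
  have hS : ∀ i, i + 1 < N → w i ⬝ᵥ (distMatrix G 1 *ᵥ w (i + 1)) ≠ 0 := by
    intro i hi
    rw [hw]
    dsimp only
    rw [hG.cellVec_dotProduct hK hx _ _ _ (he (i + 1) hi)]
    refine mul_ne_zero (heps i (by omega)) ?_
    rw [charVec_dotProduct_distMatrix_mulVec]
    have h1 : (cellPlus G x K (i + 1)).ncard ≠ 0 := by exact_mod_cast hp (i + 1) hi
    obtain ⟨z, hz⟩ := Set.nonempty_of_ncard_ne_zero h1
    obtain ⟨y, hy, hyz⟩ := exists_adj_cellPlus hG.connected hK hx hz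
    norm_cast
    exact Set.ncard_ne_zero_of_mem (a := (y, z)) ⟨hy, hz, hyz⟩
  have hent : ∀ i, i + 1 < N → perpEntry G x K D q ss i (i + 1) / perpEntry G x K D q ss (i + 1) i =
      (xi D q ss (i + 2) / xi D q ss (i + 1)) ^ 2 * (w (i + 1) ⬝ᵥ w (i + 1)) / (w i ⬝ᵥ w i) := by
    intro i hi
    have h1 := hxi i (by omega)
    have h2 := hxi (i + 1) hi
    have h3 := hS i hi
    have h4 := hnorm0 i (by omega)
    have h5 := hnorm0 (i + 1) hi
    rw [perpEntry, perpEntry, vPerp_eq_smul_cellVec, vPerp_eq_smul_cellVec]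
    change coordAlong (_ • w i) (_ *ᵥ (_ • w (i + 1))) /
      coordAlong (_ • w (i + 1)) (_ *ᵥ (_ • w i)) = _
    rw [coordAlong_smul h1 (hwstar i (by omega)), coordAlong_smul h2 (hwstar (i + 1) hi),
      dotProduct_distMatrix_mulVec G 1 (w (i + 1))]
    field_simp
  rw [← hnorm i hi, ← hnorm 0 (by omega)]
  induction i with
  | zero =>
    have h1 := hxi 0 hi
    have h2 := hnorm0 0 hi
    rw [kPerp, Finset.prod_range_zero, Finset.prod_range_zero, Nat.zero_add, div_self h1,
      div_self h2]
    simp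
  | succ i ih =>
    have h1 := hxi i (by omega)
    have h2 := hnorm0 i (by omega)
    have h3 := hxi 0 (by omega)
    have h4 := hnorm0 0 (by omega)
    have ih := ih (by omega)
    rw [kPerp] at ih ⊢
    rw [Finset.prod_range_succ, Finset.prod_range_succ, mul_div_mul_comm, ih, hent i hi]
    field_simp

end Perp

/-! ### q-Pochhammer symbols. -/

section QPochhammer

theorem qPoch_zero {R : Type*} [CommRing R] (x q : R) : qPoch x q 0 = 1 :=
  Finset.prod_range_zero _

theorem qPoch_succ {R : Type*} [CommRing R] (x q : R) (n : ℕ) :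
    qPoch x q (n + 1) = qPoch x q n * (1 - x * q ^ n) :=
  Finset.prod_range_succ _ _

theorem qPoch_succ' {R : Type*} [CommRing R] (x q : R) (n : ℕ) :
    qPoch x q (n + 1) = (1 - x) * qPoch (x * q) q n := by
  rw [qPoch, Finset.prod_range_succ', mul_comm, pow_zero, mul_one, qPoch]
  congr 1
  refine Finset.prod_congr rfl fun j _ => ?_
  ring

theorem qPoch_add {R : Type*} [CommRing R] (x q : R) (m n : ℕ) :
    qPoch x q (m + n) = qPoch x q m * qPoch (x * q ^ m) q n := by
  rw [qPoch, Finset.prod_range_add, qPoch, qPoch]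
  congr 1
  refine Finset.prod_congr rfl fun j _ => ?_
  ring

theorem qPoch_ne_zero {x q : ℂ} {n : ℕ} (h : ∀ j < n, 1 - x * q ^ j ≠ 0) : qPoch x q n ≠ 0 :=
  Finset.prod_ne_zero_iff.2 fun j hj => h j (Finset.mem_range.1 hj)

end QPochhammer

/-! ### The scalars `ϵ_i` and `ξ_i`. -/

section EpsXi

variable {D : ℕ} {q ss : ℂ}

/-- The value at 0 lets `|C_i⁻| = k_i / (1 - ϵ_i)` and the formula for `b_i (1 - ϵ_i)` include `i =
0`. -/
theorem eps_zero : eps D q ss 0 = 0 := by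
  simp [eps]

theorem eps_eq (hq0 : q ≠ 0) (i : ℕ) :
    eps D q ss i = (1 - q ^ i) * (1 - ss * (q ^ D * q ^ i * q)) /
      ((q ^ D - q ^ i) * (1 - ss * (q ^ i * q))) := by
  have h1 : q ^ D ≠ 0 := pow_ne_zero D hq0
  have h2 : q ^ D * (1 - q ^ i / q ^ D) = q ^ D - q ^ i := by field_simp
  rw [eps, zpow_sub₀ hq0, zpow_natCast, zpow_natCast, h2, pow_succ, pow_succ, pow_add]

theorem one_sub_eps_eq (hq0 : q ≠ 0) {i : ℕ} (h1 : q ^ D - q ^ i ≠ 0)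
    (h2 : 1 - ss * (q ^ i * q) ≠ 0) :
    1 - eps D q ss i = (q ^ D - 1) * (1 - ss * ((q ^ i) ^ 2 * q)) /
      ((q ^ D - q ^ i) * (1 - ss * (q ^ i * q))) := by
  rw [eps_eq hq0, eq_div_iff (mul_ne_zero h1 h2), sub_mul, div_mul_cancel₀ _ (mul_ne_zero h1 h2)]
  ring

theorem xi_eq (hq0 : q ≠ 0) (i : ℕ) :
    xi D q ss i = q / q ^ i * (1 - q ^ i / q ^ D) * (1 - ss * (q ^ i * q)) := by
  rw [xi, zpow_sub₀ hq0, zpow_sub₀ hq0, zpow_natCast, zpow_natCast, zpow_one, pow_succ]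

end EpsXi

/-! ### Intersection numbers combined with `ϵ_i`. -/

/-- The intersection numbers `b_i`, `c_i` of a distance-regular graph of `q`-Racah type. -/
structure HasRacahNumbers (D : ℕ) (q h ss r₁ r₂ : ℂ) (b c : ℕ → ℕ) : Prop where
  b_zero : (b 0 : ℂ) = h * (1 - 1 / q ^ D) * (1 - r₁ * q) * (1 - r₂ * q) / (1 - ss * q ^ 2)
  b_succ : ∀ i, i + 1 < D → (b (i + 1) : ℂ) =
    h * (1 - q ^ i * q / q ^ D) * (1 - ss * (q ^ i * q ^ 2)) *
      (1 - r₁ * (q ^ i * q ^ 2)) * (1 - r₂ * (q ^ i * q ^ 2)) /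
      ((1 - ss * ((q ^ i) ^ 2 * q ^ 3)) * (1 - ss * ((q ^ i) ^ 2 * q ^ 4)))
  c_succ : ∀ i, i + 1 < D → (c (i + 1) : ℂ) =
    h * (1 - q ^ i * q) * (1 - ss * (q ^ i * q ^ D * q ^ 2)) *
      (r₁ - ss * (q ^ i * q)) * (r₂ - ss * (q ^ i * q)) /
      (ss * q ^ D * (1 - ss * ((q ^ i) ^ 2 * q ^ 2)) * (1 - ss * ((q ^ i) ^ 2 * q ^ 3)))
  c_last : ∀ i, i + 1 = D → (c (i + 1) : ℂ) = h * (1 - q ^ i * q) *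
      (r₁ - ss * (q ^ i * q)) * (r₂ - ss * (q ^ i * q)) /
      (ss * (q ^ i * q) * (1 - ss * ((q ^ i) ^ 2 * q ^ 2)))

namespace IsQRacah

variable {D : ℕ} {q h hs s ss r₁ r₂ : ℂ} {θ θs φ ϕ : ℕ → ℂ} {b c : ℕ → ℕ}

theorem one_sub_ne (H : IsQRacah D q h hs s ss r₁ r₂ θ θs φ ϕ) {i : ℕ} (hi : 1 ≤ i)
    (hi' : i < 2 * D) : 1 - ss * (q ^ i * q) ≠ 0 := by
  rw [← pow_succ]
  exact H.one_sub_ss_ne_zero (by omega) (by omega)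

theorem one_sub_eps_ne_zero (H : IsQRacah D q h hs s ss r₁ r₂ θ θs φ ϕ) (hq0 : q ≠ 0)
    (hq : ∀ n : ℕ, 0 < n → q ^ n ≠ 1) {i : ℕ} (hi : i < D) : 1 - eps D q ss i ≠ 0 := by
  rcases Nat.eq_zero_or_pos i with rfl | h0
  · rw [eps_zero, sub_zero]
    exact one_ne_zero
  have h1 : q ^ D - q ^ i ≠ 0 := sub_ne_zero.2 (pow_ne_pow hq0 hq (by omega))
  have h2 := H.one_sub_ne (show 1 ≤ i by omega) (by omega)
  rw [one_sub_eps_eq hq0 h1 h2]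
  refine div_ne_zero (mul_ne_zero (sub_ne_zero.2 (hq D (by omega))) ?_) (mul_ne_zero h1 h2)
  rw [← pow_mul, ← pow_succ]
  exact H.one_sub_ss_ne_zero (by omega) (by omega)

theorem eps_ne_zero (H : IsQRacah D q h hs s ss r₁ r₂ θ θs φ ϕ) (hq0 : q ≠ 0)
    (hq : ∀ n : ℕ, 0 < n → q ^ n ≠ 1) {i : ℕ} (hi0 : 1 ≤ i) (hi : i < D) :
    eps D q ss i ≠ 0 := by
  rw [eps_eq hq0]
  refine div_ne_zero (mul_ne_zero (sub_ne_zero.2 (hq i hi0).symm) ?_)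
    (mul_ne_zero (sub_ne_zero.2 (pow_ne_pow hq0 hq (by omega))) (H.one_sub_ne hi0 (by omega)))
  rw [← pow_add]
  exact H.one_sub_ne (by omega) (by omega)

theorem xi_ne_zero (H : IsQRacah D q h hs s ss r₁ r₂ θ θs φ ϕ) (hq0 : q ≠ 0)
    (hq : ∀ n : ℕ, 0 < n → q ^ n ≠ 1) {i : ℕ} (hi0 : 1 ≤ i) (hi : i < D) :
    xi D q ss i ≠ 0 := by
  rw [xi_eq hq0]
  exact mul_ne_zero (mul_ne_zero (div_ne_zero hq0 (pow_ne_zero i hq0))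
    (one_sub_div_ne_zero hq0 hq hi)) (H.one_sub_ne hi0 (by omega))

theorem b_mul_one_sub_eps (H : IsQRacah D q h hs s ss r₁ r₂ θ θs φ ϕ) (hq0 : q ≠ 0)
    (hq : ∀ n : ℕ, 0 < n → q ^ n ≠ 1) (hR : HasRacahNumbers D q h ss r₁ r₂ b c) {i : ℕ}
    (hi : i < D) :
    b i * (1 - eps D q ss i) = h * (1 - 1 / q ^ D) * (1 - r₁ * (q ^ i * q)) *
      (1 - r₂ * (q ^ i * q)) / (1 - ss * ((q ^ i) ^ 2 * q ^ 2)) := by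
  rcases i with _ | i
  · rw [eps_zero, hR.b_zero]
    simp
  · have h1 : q ^ D - q ^ (i + 1) ≠ 0 := sub_ne_zero.2 (pow_ne_pow hq0 hq (by omega))
    have h2 := H.one_sub_ne (show 1 ≤ i + 1 by omega) (show i + 1 < 2 * D by omega)
    rw [one_sub_eps_eq hq0 h1 h2, hR.b_succ i hi]
    have h3 : 1 - ss * ((q ^ i) ^ 2 * q ^ 3) ≠ 0 := by
      rw [← pow_mul, ← pow_add]
      exact H.one_sub_ss_ne_zero (by omega) (by omega)
    have h4 : 1 - ss * ((q ^ i) ^ 2 * q ^ 4) ≠ 0 := by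
      rw [← pow_mul, ← pow_add]
      exact H.one_sub_ss_ne_zero (by omega) (by omega)
    have h5 : q ^ D ≠ 0 := pow_ne_zero D hq0
    rw [pow_succ q i] at *
    have e1 : 1 - ss * (q ^ i * q * q) = 1 - ss * (q ^ i * q ^ 2) := by ring
    have e2 : 1 - ss * ((q ^ i * q) ^ 2 * q) = 1 - ss * ((q ^ i) ^ 2 * q ^ 3) := by ring
    have e3 : 1 - ss * ((q ^ i * q) ^ 2 * q ^ 2) = 1 - ss * ((q ^ i) ^ 2 * q ^ 4) := by ring
    rw [e1] at h2
    rw [e1, e2, e3]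
    generalize 1 - ss * (q ^ i * q ^ 2) = Y at *
    generalize 1 - ss * ((q ^ i) ^ 2 * q ^ 3) = Z at *
    generalize 1 - ss * ((q ^ i) ^ 2 * q ^ 4) = W at *
    generalize q ^ i = Q at *
    generalize q ^ D = N at *
    field_simp

/-- The relation between the intersection numbers, the split sequences and the scalars `ϵ_i` that
governs the sizes of the cells. -/
theorem c_mul_phi (H : IsQRacah D q h hs s ss r₁ r₂ θ θs φ ϕ) (hq0 : q ≠ 0)
    (hq : ∀ n : ℕ, 0 < n → q ^ n ≠ 1) (hR : HasRacahNumbers D q h ss r₁ r₂ b c) {i : ℕ}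
    (hi : i + 1 < D) :
    c (i + 1) * φ (i + 1) * (1 - eps D q ss (i + 1)) =
      b i * (1 - eps D q ss i) * ϕ (i + 1) * eps D q ss (i + 1) := by
  have h1 : q ^ D - q ^ (i + 1) ≠ 0 := sub_ne_zero.2 (pow_ne_pow hq0 hq (by omega))
  have h2 := H.one_sub_ne (show 1 ≤ i + 1 by omega) (show i + 1 < 2 * D by omega)
  have h3 : 1 - ss * ((q ^ i) ^ 2 * q ^ 2) ≠ 0 := by
    rw [← pow_mul, ← pow_add]
    exact H.one_sub_ss_ne_zero (by omega) (by omega)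
  have h4 : 1 - ss * ((q ^ i) ^ 2 * q ^ 3) ≠ 0 := by
    rw [← pow_mul, ← pow_add]
    exact H.one_sub_ss_ne_zero (by omega) (by omega)
  have h5 : q ^ D ≠ 0 := pow_ne_zero D hq0
  have h6 : q ^ i ≠ 0 := pow_ne_zero i hq0
  have h7 := H.ss_ne
  rw [H.b_mul_one_sub_eps hq0 hq hR (by omega), one_sub_eps_eq hq0 h1 h2, eps_eq hq0,
    hR.c_succ i hi, H.phi_one_succ hq0 (by omega), H.phi_two_succ hq0 (by omega)]
  rw [pow_succ q i] at *
  have e2 : 1 - ss * ((q ^ i * q) ^ 2 * q) = 1 - ss * ((q ^ i) ^ 2 * q ^ 3) := by ring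
  have e3 : 1 - ss * (q ^ D * (q ^ i * q) * q) = 1 - ss * (q ^ i * q ^ D * q ^ 2) := by ring
  rw [e2, e3]
  generalize 1 - ss * (q ^ i * q * q) = Y at *
  generalize 1 - ss * ((q ^ i) ^ 2 * q ^ 3) = Z at *
  generalize 1 - ss * ((q ^ i) ^ 2 * q ^ 2) = W at *
  generalize q ^ i = Q at *
  generalize q ^ D = N at *
  field_simp

end IsQRacah

/-! ### From the graph to its intersection numbers and `k_i^⊥`. -/

section Graph

variable {X : Type*} [Fintype X] [DecidableEq X] {G : SimpleGraph X} {a b c : ℕ → ℕ} {D : ℕ}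
  {θ : ℕ → ℝ} {E : ℕ → Matrix X X ℂ} {K : Finset X} {x : X} {θs φ ϕ : ℕ → ℂ}
  {q h hs s ss r₁ r₂ : ℂ}

theorem hasRacahNumbers (hD : 3 ≤ D) (hdiam : G.diam = D) (hG : IsDistanceRegular G a b c)
    (hE : IsEigenOrdering G D θ E) (hQ : IsQPolynomial D E) (hθs : IsDualEigenvalues G E x θs)
    (hpar : IsParameterArray (distMatrix G 1) (dualAdj E x) (primaryModule G x) D
      (fun i => (θ i : ℂ)) θs φ ϕ)
    (hq0 : q ≠ 0) (hq : ∀ n : ℕ, 0 < n → q ^ n ≠ 1)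
    (H : IsQRacah D q h hs s ss r₁ r₂ (fun i => (θ i : ℂ)) θs φ ϕ) :
    HasRacahNumbers D q h ss r₁ r₂ b c ∧
      ∃ γ : ℕ → ℂ, (∀ j ≤ D, γ j ≠ 0) ∧ (∀ j < D, γ (j + 1) * φ (j + 1) = γ j * ϕ (j + 1)) ∧
        ∀ j ≤ D, c j * γ (j - 1) + a j * γ j + b j * γ (j + 1) = (θ D : ℂ) * γ j := by
  subst hdiam
  obtain ⟨γ, hγ⟩ := hG.exists_splitCoeff hθs hpar.1
  obtain ⟨γ', hγ'⟩ := hG.exists_splitCoeff hθs hpar.2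
  have hinj := H.thetas_injOn hq0 hq
  have hφ := H.phi_one_ne_zero hq0 hq
  have hϕ := H.phi_two_ne_zero hq0 hq
  have hbD : (b G.diam : ℂ) = 0 := by exact_mod_cast hG.b_diam
  have hb : ∀ j < G.diam, (b j : ℂ) ≠ 0 := fun j hj => by exact_mod_cast hG.b_ne_zero hj
  have hc : ∀ j < G.diam, (c (j + 1) : ℂ) ≠ 0 := fun j hj => by exact_mod_cast hG.c_ne_zero hj
  have hc0 : (c 0 : ℂ) = 0 := by exact_mod_cast hG.c_zero
  have hsum : ∀ j ≤ G.diam, (c j : ℂ) + a j + b j = θ 0 := fun j hj => by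
    rw [hE.theta_zero hG hQ, hG.sum_eq hj]
  have hcs : ∀ j < G.diam, _ := fun j hj =>
    hγ'.c_succ hinj hbD hc hϕ hc0 hb (by simpa using hsum) hj
  have hcs' : ∀ i, i + 1 < G.diam → _ := fun i hi =>
    H.c_eq hq0 hq (c := fun i => (c i : ℂ)) hi (hcs i (by omega))
  refine ⟨⟨?_, ?_, hcs', ?_⟩, γ G.diam, ?_, ?_, hγ.top⟩
  · exact H.b_zero hq0 hq (a := fun i => (a i : ℂ)) (b := fun i => (b i : ℂ))
      (c := fun i => (c i : ℂ)) (by omega) (hsum 0 (by omega)) hc0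
      (hγ.a_zero hinj hbD hc hc0 (by omega))
  · intro i hi
    exact H.b_eq hq0 hq (a := fun i => (a i : ℂ)) (b := fun i => (b i : ℂ))
      (c := fun i => (c i : ℂ)) hi (hsum (i + 1) (by omega)) (hγ.a_succ hinj hbD hc hi) (hcs' i hi)
  · intro i hi
    exact H.c_last hq0 hq (c := fun i => (c i : ℂ)) hi (hcs i (by omega))
  · exact fun j hj => hγ.last_ne_zero hinj hbD hc hφ hj
  · exact fun j hj => hγ.last_ratio hinj hbD hj (hcs j hj)

/-- The cell sizes are `|C_i⁻| = k_i / (1 - ϵ_i)` and `|C_{i-1}⁺| = -k_i ϵ_i / (1 - ϵ_i)`. Inserting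
them in `kPerp_eq` cancels the factors `1 - ϵ`. -/
theorem kPerp_eq_kNum (hD : 3 ≤ D) (hdiam : G.diam = D) (hG : IsDistanceRegular G a b c)
    (hE : IsEigenOrdering G D θ E) (hmin : ∀ i ≤ D, θ D ≤ θ i)
    (hK : IsDelsarteClique G (b 0) K) (hx : x ∈ K)
    (hq0 : q ≠ 0) (hq : ∀ n : ℕ, 0 < n → q ^ n ≠ 1)
    (H : IsQRacah D q h hs s ss r₁ r₂ (fun i => (θ i : ℂ)) θs φ ϕ)
    (hR : HasRacahNumbers D q h ss r₁ r₂ b c) {γ : ℕ → ℂ} (hγ0 : ∀ j ≤ D, γ j ≠ 0)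
    (hγr : ∀ j < D, γ (j + 1) * φ (j + 1) = γ j * ϕ (j + 1))
    (hγ : ∀ j ≤ D, c j * γ (j - 1) + a j * γ j + b j * γ (j + 1) = (θ D : ℂ) * γ j)
    {i : ℕ} (hi : i + 1 < D) :
    kPerp G x K D q ss i = (xi D q ss (i + 1) / xi D q ss 1) ^ 2 *
      (kNum b c (i + 1) * eps D q ss (i + 1) / (kNum b c 1 * eps D q ss 1)) := by
  subst hdiam
  obtain ⟨-, hcl, τ, hτ, hcard⟩ := hK
  have hτ' : τ = θ G.diam := by
    apply le_antisymm
    · exact hτ.2 ((hE.eigenvalue_iff _).2 ⟨G.diam, le_rfl, rfl⟩)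
    · obtain ⟨i, hi, hi'⟩ := (hE.eigenvalue_iff _).1 hτ.1
      rw [Complex.ofReal_inj.1 hi']
      exact hmin i hi
  subst hτ'
  have hb0 : (b 0 : ℂ) ≠ 0 := by exact_mod_cast hG.b_ne_zero (by omega)
  have hθ : θ G.diam ≠ 0 := by
    intro h0
    have h1 := hγ 0 (by omega)
    rw [h0, hG.c_zero, hG.a_zero] at h1
    have h2 : (b 0 : ℂ) * γ 1 = 0 := by simpa using h1
    exact mul_ne_zero hb0 (hγ0 1 (by omega)) h2
  have hsum := hG.sum_clique_eq_zero hθ hγ hcl hcard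
  have h1e : ∀ i < G.diam, 1 - eps G.diam q ss i ≠ 0 :=
    fun i hi => H.one_sub_eps_ne_zero hq0 hq hi
  have hkc : ∀ i < G.diam, kNum b c (i + 1) * c (i + 1) = kNum b c i * b i := by
    intro i hi
    have hc : (c (i + 1) : ℂ) ≠ 0 := by exact_mod_cast hG.c_ne_zero hi
    rw [kNum_succ, div_mul_cancel₀ _ hc]
  -- The candidates for `|C_i⁻|` and `|C_i⁺|` solve `p_i + m_{i+1} = k_{i+1}` together with `p_i +
  -- ϵ_{i+1} m_{i+1} = 0`. The cosine condition `hmp` is checked from `c_mul_phi`. The recursion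
  -- stops at `D - 1` because the denominator of `ϵ_D` is zero.
  set m : ℕ → ℂ := fun i => kNum b c i / (1 - eps G.diam q ss i) with hm
  set p : ℕ → ℂ := fun i =>
    - (kNum b c (i + 1) * eps G.diam q ss (i + 1) / (1 - eps G.diam q ss (i + 1))) with hp
  have hcell := fun i (hi : i ≤ G.diam - 1) =>
    hG.cell_ncard hcl hsum (N := G.diam - 1) (by omega) (fun i hi => hγ0 (i + 1) (by omega))
      (m := m) (p := p) (by simp [hm, eps_zero, kNum]) (by
        intro i hi
        have h1 := h1e i (by omega)
        have h2 := h1e (i + 1) (by omega)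
        have h3 := H.c_mul_phi hq0 hq hR (i := i) (by omega)
        have h4 := hkc i (by omega)
        have h5 := hγr i (by omega)
        have h6 := H.phi_one_ne_zero hq0 hq i (by omega)
        have h7 : (c (i + 1) : ℂ) ≠ 0 := by exact_mod_cast hG.c_ne_zero (by omega)
        have h8 := hG.kNum_ne_zero (i := i + 1) (by omega)
        rw [hm, hp]
        dsimp only
        have h9 : kNum b c i * (1 - eps G.diam q ss (i + 1)) * φ (i + 1) =
            kNum b c (i + 1) * eps G.diam q ss (i + 1) * (1 - eps G.diam q ss i) *
              ϕ (i + 1) := by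
          apply mul_right_cancel₀ h7
          linear_combination kNum b c i * h3 -
            (1 - eps G.diam q ss i) * ϕ (i + 1) * eps G.diam q ss (i + 1) * h4
        field_simp
        apply mul_right_cancel₀ h6
        linear_combination γ i * h9 -
          kNum b c (i + 1) * eps G.diam q ss (i + 1) * (1 - eps G.diam q ss i) * h5) (by
        intro i hi
        have h2 := h1e (i + 1) (by omega)
        rw [hm, hp]
        dsimp only
        field_simp
        ring) hi
  have hplus : ∀ i < G.diam - 1, ((cellPlus G x K i).ncard : ℂ) = p i :=
    fun i hi => (hcell i (by omega)).2 hi x hx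
  have hminus : ∀ i ≤ G.diam - 1, ((cellMinus G x K i).ncard : ℂ) = m i :=
    fun i hi => (hcell i (by omega)).1 x hx
  have hk : ∀ i ≤ G.diam, kNum b c i ≠ 0 := fun i hi => hG.kNum_ne_zero hi
  rw [hG.kPerp_eq hcl hx (N := G.diam - 1)
    (fun i hi => H.xi_ne_zero hq0 hq (by omega) (by omega))
    (fun i hi => h1e (i + 1) (by omega)) ?_ ?_ (by omega), hplus i (by omega),
    hplus 0 (by omega)]
  · have h1 := h1e (i + 1) hi
    have h2 := h1e 1 (by omega)
    have h3 : p i * (1 - eps G.diam q ss (i + 1)) =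
        - (kNum b c (i + 1) * eps G.diam q ss (i + 1)) := by
      rw [hp]
      dsimp only
      field_simp
    have h4 : p 0 * (1 - eps G.diam q ss 1) = - (kNum b c 1 * eps G.diam q ss 1) := by
      rw [hp]
      dsimp only
      field_simp
    rw [h3, h4, neg_div_neg_eq]
  · intro i hi
    rw [hplus i hi]
    exact neg_ne_zero.2 (div_ne_zero (mul_ne_zero (hk _ (by omega))
      (H.eps_ne_zero hq0 hq (by omega) (by omega))) (h1e _ (by omega)))
  · intro i hi
    rw [hplus i hi, hminus (i + 1) (by omega)]
    have h1 := h1e (i + 1) (by omega)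
    rw [hm, hp]
    dsimp only
    field_simp
    ring

end Graph

/-! ### Askey-Wilson parameters and the numbers `k_i`. -/

/-- The relations between the Askey-Wilson parameters and the `q`-Racah parameters. -/
structure IsAskeyWilsonParam (D : ℕ) (q ss r₁ r₂ a b c d : ℂ) : Prop where
  a_ne : a ≠ 0
  ab : a * b = 1 / q ^ D
  ac : a * c = r₂ * q
  ad : a * d = r₁ * q
  bc : b * c = ss * q / r₁
  bd : b * d = ss * q / r₂
  cd : c * d = ss * (q ^ D * q ^ 2)
  abcd : a * b * c * d = ss * q ^ 2
  a_sq : a ^ 2 = r₁ * r₂ / (ss * q ^ D)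

/-- Square roots disappear from `a²` and from all pairwise products of `a, b, c, d`, and the scalar
identities below use only these relations. -/
theorem isAskeyWilsonParam_of_sqrt {D : ℕ} {q q' ss ss' r₁ r₁' r₂ r₂' a b c d : ℂ} (hq0 : q ≠ 0)
    (hss : ss ≠ 0) (hr₁ : r₁ ≠ 0) (hr₂ : r₂ ≠ 0)
    (hq' : q' ^ 2 = q) (hss' : ss' ^ 2 = ss) (hr₁' : r₁' ^ 2 = r₁) (hr₂' : r₂' ^ 2 = r₂)
    (ha : a = r₁' * r₂' / (ss' * q' ^ D)) (hb : b = ss' / (r₁' * r₂' * q' ^ D))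
    (hc : c = r₂' * ss' * q' ^ (D + 2) / r₁') (hd : d = r₁' * ss' * q' ^ (D + 2) / r₂') :
    IsAskeyWilsonParam D q ss r₁ r₂ a b c d := by
  subst hq' hss' hr₁' hr₂' ha hb hc hd
  have h1 : q' ≠ 0 := (pow_ne_zero_iff two_ne_zero).1 hq0
  have h2 : ss' ≠ 0 := (pow_ne_zero_iff two_ne_zero).1 hss
  have h3 : r₁' ≠ 0 := (pow_ne_zero_iff two_ne_zero).1 hr₁
  have h4 : r₂' ≠ 0 := (pow_ne_zero_iff two_ne_zero).1 hr₂
  have h5 : q' ^ D ≠ 0 := pow_ne_zero D h1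
  have h6 : (q' ^ 2) ^ D = (q' ^ D) ^ 2 := pow_right_comm q' 2 D
  have h7 : q' ^ (D + 2) = q' ^ D * q' ^ 2 := pow_add q' D 2
  rw [h7]
  constructor
  · positivity
  all_goals
    try rw [h6]
    generalize q' ^ D = N at *
    field_simp

section

variable {D : ℕ} {q h hs s ss r₁ r₂ a b c d : ℂ} {θ θs φ ϕ : ℕ → ℂ} {bi ci : ℕ → ℕ}

namespace IsAskeyWilsonParam

theorem one_sub_q_ne (hq : ∀ n : ℕ, 0 < n → q ^ n ≠ 1) (j : ℕ) : 1 - q * q ^ j ≠ 0 := by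
  rw [mul_comm]
  exact IsQRacah.one_sub_ne_zero hq j

theorem one_sub_ab_ne (hP : IsAskeyWilsonParam D q ss r₁ r₂ a b c d) (hq0 : q ≠ 0)
    (hq : ∀ n : ℕ, 0 < n → q ^ n ≠ 1) {j : ℕ} (hj : j < D) : 1 - a * b * q ^ j ≠ 0 := by
  rw [hP.ab, one_div_mul_eq_div]
  exact IsQRacah.one_sub_div_ne_zero hq0 hq hj

theorem one_sub_bc_mul (hP : IsAskeyWilsonParam D q ss r₁ r₂ a b c d) (hr₁ : r₁ ≠ 0) (j : ℕ) :
    r₁ * (1 - b * c * q ^ j) = r₁ - ss * (q ^ j * q) := by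
  rw [hP.bc]
  field_simp

theorem one_sub_bd_mul (hP : IsAskeyWilsonParam D q ss r₁ r₂ a b c d) (hr₂ : r₂ ≠ 0) (j : ℕ) :
    r₂ * (1 - b * d * q ^ j) = r₂ - ss * (q ^ j * q) := by
  rw [hP.bd]
  field_simp

theorem one_sub_bc_ne (hP : IsAskeyWilsonParam D q ss r₁ r₂ a b c d)
    (H : IsQRacah D q h hs s ss r₁ r₂ θ θs φ ϕ) {j : ℕ} (hj : j < D) :
    1 - b * c * q ^ j ≠ 0 := by
  have h1 := H.r₁_sub_ne_zero hj
  rw [← hP.one_sub_bc_mul H.r₁_ne] at h1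
  exact right_ne_zero_of_mul h1

theorem one_sub_bd_ne (hP : IsAskeyWilsonParam D q ss r₁ r₂ a b c d)
    (H : IsQRacah D q h hs s ss r₁ r₂ θ θs φ ϕ) {j : ℕ} (hj : j < D) :
    1 - b * d * q ^ j ≠ 0 := by
  have h1 := H.r₂_sub_ne_zero hj
  rw [← hP.one_sub_bd_mul H.r₂_ne] at h1
  exact right_ne_zero_of_mul h1

theorem one_sub_cd_ne (hP : IsAskeyWilsonParam D q ss r₁ r₂ a b c d)
    (H : IsQRacah D q h hs s ss r₁ r₂ θ θs φ ϕ) {j : ℕ} (hj : j + 2 ≤ D) :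
    1 - c * d * q ^ j ≠ 0 := by
  rw [hP.cd, mul_assoc, ← pow_add, ← pow_add]
  exact H.one_sub_ss_ne_zero (by omega) (by omega)

theorem one_sub_abcd_ne (hP : IsAskeyWilsonParam D q ss r₁ r₂ a b c d)
    (H : IsQRacah D q h hs s ss r₁ r₂ θ θs φ ϕ) {j : ℕ} (hj : j + 2 ≤ 2 * D) :
    1 - a * b * c * d * q ^ j ≠ 0 := by
  rw [hP.abcd, mul_assoc, ← pow_add]
  exact H.one_sub_ss_ne_zero (by omega) (by omega)

/-- The ratio of consecutive `k_i` in terms of the Askey-Wilson parameters. -/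
theorem b_mul_eq (hP : IsAskeyWilsonParam D q ss r₁ r₂ a b c d)
    (H : IsQRacah D q h hs s ss r₁ r₂ θ θs φ ϕ) (hq0 : q ≠ 0)
    (hR : HasRacahNumbers D q h ss r₁ r₂ bi ci) {j : ℕ} (hj : j + 2 < D) :
    (bi (j + 1) : ℂ) * (a ^ 2 * ((1 - q * q ^ (j + 1)) * (1 - b * c * q ^ (j + 1)) *
        (1 - b * d * q ^ (j + 1)) * (1 - c * d * q ^ (j + 1)))) *
        (1 - a * b * c * d * q ^ (2 * j + 1)) =
      ci (j + 2) * ((1 - a * b * c * d * q ^ j) * ((1 - a * b * q ^ (j + 1)) *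
        (1 - a * c * q ^ (j + 1)) * (1 - a * d * q ^ (j + 1)))) *
        (1 - a * b * c * d * q ^ (2 * j + 3)) := by
  have h3 : 1 - ss * ((q ^ j) ^ 2 * q ^ 3) ≠ 0 := by
    rw [← pow_mul, ← pow_add]
    exact H.one_sub_ss_ne_zero (by omega) (by omega)
  have h4 : 1 - ss * ((q ^ j) ^ 2 * q ^ 4) ≠ 0 := by
    rw [← pow_mul, ← pow_add]
    exact H.one_sub_ss_ne_zero (by omega) (by omega)
  have h6 : 1 - ss * ((q ^ j) ^ 2 * q ^ 5) ≠ 0 := by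
    rw [← pow_mul, ← pow_add]
    exact H.one_sub_ss_ne_zero (by omega) (by omega)
  have e1 : (q ^ (j + 1)) ^ 2 * q ^ 2 = (q ^ j) ^ 2 * q ^ 4 := by ring
  have e2 : (q ^ (j + 1)) ^ 2 * q ^ 3 = (q ^ j) ^ 2 * q ^ 5 := by ring
  have h5 : q ^ D ≠ 0 := pow_ne_zero D hq0
  have h7 := H.r₁_ne
  have h8 := H.r₂_ne
  have h9 := H.ss_ne
  rw [hR.b_succ j (by omega), hR.c_succ (j + 1) hj, e1, e2, ← hP.one_sub_bc_mul h7,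
    ← hP.one_sub_bd_mul h8, hP.a_sq, hP.cd, hP.abcd, hP.ab, hP.ac, hP.ad]
  generalize 1 - b * c * q ^ (j + 1) = B
  generalize 1 - b * d * q ^ (j + 1) = B'
  have e3 : 1 - ss * q ^ 2 * q ^ (2 * j + 1) = 1 - ss * ((q ^ j) ^ 2 * q ^ 3) := by ring
  have e4 : 1 - ss * q ^ 2 * q ^ (2 * j + 3) = 1 - ss * ((q ^ j) ^ 2 * q ^ 5) := by ring
  rw [e3, e4, pow_succ q j]
  generalize 1 - ss * ((q ^ j) ^ 2 * q ^ 3) = Y at *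
  generalize 1 - ss * ((q ^ j) ^ 2 * q ^ 4) = Z at *
  generalize 1 - ss * ((q ^ j) ^ 2 * q ^ 5) = W at *
  generalize q ^ j = Q at *
  generalize q ^ D = N at *
  field_simp

theorem b_zero_mul_eq (hP : IsAskeyWilsonParam D q ss r₁ r₂ a b c d)
    (H : IsQRacah D q h hs s ss r₁ r₂ θ θs φ ϕ) (hq0 : q ≠ 0)
    (hR : HasRacahNumbers D q h ss r₁ r₂ bi ci) (hD : 1 < D) :
    (bi 0 : ℂ) * (a ^ 2 * ((1 - q) * (1 - b * c) * (1 - b * d) * (1 - c * d))) =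
      ci 1 * ((1 - a * b * c * d * q) * ((1 - a * b) * (1 - a * c) * (1 - a * d))) := by
  have h3 : 1 - ss * q ^ 2 ≠ 0 := H.one_sub_ss_ne_zero (by omega) (by omega)
  have h4 : 1 - ss * q ^ 3 ≠ 0 := H.one_sub_ss_ne_zero (by omega) (by omega)
  have h5 : q ^ D ≠ 0 := pow_ne_zero D hq0
  have h7 := H.r₁_ne
  have h8 := H.r₂_ne
  have h9 := H.ss_ne
  have e1 := hP.one_sub_bc_mul h7 0
  have e2 := hP.one_sub_bd_mul h8 0
  have e3 := hR.c_succ 0 hD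
  simp only [pow_zero, mul_one, one_mul, one_pow, Nat.zero_add] at e1 e2 e3
  rw [hR.b_zero, e3, ← e1, ← e2, hP.a_sq, hP.cd, hP.abcd, hP.ab, hP.ac, hP.ad]
  have e4 : 1 - ss * q ^ 2 * q = 1 - ss * q ^ 3 := by ring
  rw [e4]
  generalize 1 - ss * q ^ 2 = Y at *
  generalize 1 - ss * q ^ 3 = Z at *
  generalize 1 - b * c = B
  generalize 1 - b * d = B'
  generalize q ^ D = N at *
  field_simp

/-- The factors `1 - cd q^{D-1}` and `1 - abcd q^{2D-1}` of the general ratio both equal `1 - s*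
q^{2D+1}`, possibly zero, and are omitted. This is why the final formula has `(cd; q)_{D-1}` and
`(abcd; q)_{2D-1}`. -/
theorem b_last_mul_eq (hP : IsAskeyWilsonParam D q ss r₁ r₂ a b c d)
    (H : IsQRacah D q h hs s ss r₁ r₂ θ θs φ ϕ) (hq0 : q ≠ 0)
    (hR : HasRacahNumbers D q h ss r₁ r₂ bi ci) {j : ℕ} (hj : j + 2 = D) :
    (bi (j + 1) : ℂ) * (a ^ 2 * ((1 - q * q ^ (j + 1)) * (1 - b * c * q ^ (j + 1)) *
        (1 - b * d * q ^ (j + 1)))) * (1 - a * b * c * d * q ^ (2 * j + 1)) =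
      ci (j + 2) * ((1 - a * b * c * d * q ^ j) * ((1 - a * b * q ^ (j + 1)) *
        (1 - a * c * q ^ (j + 1)) * (1 - a * d * q ^ (j + 1)))) := by
  have h3 : 1 - ss * ((q ^ j) ^ 2 * q ^ 3) ≠ 0 := by
    rw [← pow_mul, ← pow_add]
    exact H.one_sub_ss_ne_zero (by omega) (by omega)
  have h4 : 1 - ss * ((q ^ j) ^ 2 * q ^ 4) ≠ 0 := by
    rw [← pow_mul, ← pow_add]
    exact H.one_sub_ss_ne_zero (by omega) (by omega)
  have e1 : (q ^ (j + 1)) ^ 2 * q ^ 2 = (q ^ j) ^ 2 * q ^ 4 := by ring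
  have h5 : q ^ j ≠ 0 := pow_ne_zero j hq0
  have h7 := H.r₁_ne
  have h8 := H.r₂_ne
  have h9 := H.ss_ne
  have hD : q ^ D = q ^ j * q ^ 2 := by rw [← hj, pow_add]
  rw [hR.b_succ j (by omega), hR.c_last (j + 1) hj, e1, ← hP.one_sub_bc_mul h7,
    ← hP.one_sub_bd_mul h8, hP.a_sq, hP.abcd, hP.ab, hP.ac, hP.ad, hD]
  generalize 1 - b * c * q ^ (j + 1) = B
  generalize 1 - b * d * q ^ (j + 1) = B'
  have e3 : 1 - ss * q ^ 2 * q ^ (2 * j + 1) = 1 - ss * ((q ^ j) ^ 2 * q ^ 3) := by ring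
  rw [e3, pow_succ q j]
  generalize 1 - ss * ((q ^ j) ^ 2 * q ^ 3) = Y at *
  generalize 1 - ss * ((q ^ j) ^ 2 * q ^ 4) = Z at *
  generalize q ^ j = Q at *
  field_simp

/-- The ratios `b_j / c_{j+1}` are multiplied up. The usual factor `1 - abcd/q = 1 - s* q` is
already cancelled, which is why the product `(abcd; q)_j` is one step shorter than the others. -/
theorem kNum_mul_eq (hP : IsAskeyWilsonParam D q ss r₁ r₂ a b c d)
    (H : IsQRacah D q h hs s ss r₁ r₂ θ θs φ ϕ) (hq0 : q ≠ 0)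
    (hR : HasRacahNumbers D q h ss r₁ r₂ bi ci) (hci : ∀ j < D, (ci (j + 1) : ℂ) ≠ 0) {j : ℕ}
    (hj : j + 1 < D) :
    kNum bi ci (j + 1) * ((a ^ 2) ^ (j + 1) * (qPoch q q (j + 1) * qPoch (b * c) q (j + 1) *
        qPoch (b * d) q (j + 1) * qPoch (c * d) q (j + 1))) =
      (1 - a * b * c * d * q ^ (2 * j + 1)) * (qPoch (a * b * c * d) q j *
        (qPoch (a * b) q (j + 1) * qPoch (a * c) q (j + 1) * qPoch (a * d) q (j + 1))) := by
  induction j with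
  | zero =>
    have h1 := hP.b_zero_mul_eq H hq0 hR hj
    have h2 := hci 0 (by omega)
    rw [kNum_succ]
    simp only [qPoch_succ, qPoch_zero, kNum, Finset.prod_range_zero, pow_zero, Nat.zero_add,
      pow_one, mul_one, one_mul, div_one, Nat.mul_zero] at h2 ⊢
    rw [div_mul_eq_mul_div, div_eq_iff h2]
    linear_combination h1
  | succ j ih =>
    have h1 := hP.b_mul_eq H hq0 hR hj
    have h2 := hci (j + 1) (by omega)
    have h3 : 1 - a * b * c * d * q ^ (2 * j + 1) ≠ 0 := hP.one_sub_abcd_ne H (by omega)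
    have ih := ih (by omega)
    rw [show 2 * (j + 1) + 1 = 2 * j + 3 by ring, kNum_succ, pow_succ (a ^ 2) (j + 1),
      qPoch_succ q q (j + 1), qPoch_succ (b * c) q (j + 1), qPoch_succ (b * d) q (j + 1),
      qPoch_succ (c * d) q (j + 1), qPoch_succ (a * b) q (j + 1), qPoch_succ (a * c) q (j + 1),
      qPoch_succ (a * d) q (j + 1), qPoch_succ (a * b * c * d) q j]
    rw [div_mul_eq_mul_div, div_eq_iff h2]
    apply mul_right_cancel₀ h3
    linear_combination
      (bi (j + 1) : ℂ) * (a ^ 2 * ((1 - q * q ^ (j + 1)) * (1 - b * c * q ^ (j + 1)) *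
        (1 - b * d * q ^ (j + 1)) * (1 - c * d * q ^ (j + 1)))) *
        (1 - a * b * c * d * q ^ (2 * j + 1)) * ih +
      (1 - a * b * c * d * q ^ (2 * j + 1)) * (qPoch (a * b * c * d) q j *
        (qPoch (a * b) q (j + 1) * qPoch (a * c) q (j + 1) * qPoch (a * d) q (j + 1))) * h1

theorem kNum_last_mul_eq (hP : IsAskeyWilsonParam D q ss r₁ r₂ a b c d)
    (H : IsQRacah D q h hs s ss r₁ r₂ θ θs φ ϕ) (hq0 : q ≠ 0)
    (hR : HasRacahNumbers D q h ss r₁ r₂ bi ci) (hci : ∀ j < D, (ci (j + 1) : ℂ) ≠ 0) {j : ℕ}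
    (hj : j + 2 = D) :
    kNum bi ci (j + 2) * ((a ^ 2) ^ (j + 2) * (qPoch q q (j + 2) * qPoch (b * c) q (j + 2) *
        qPoch (b * d) q (j + 2) * qPoch (c * d) q (j + 1))) =
      qPoch (a * b * c * d) q (j + 1) *
        (qPoch (a * b) q (j + 2) * qPoch (a * c) q (j + 2) * qPoch (a * d) q (j + 2)) := by
  have h1 := hP.b_last_mul_eq H hq0 hR hj
  have h2 := hci (j + 1) (by omega)
  have h3 : 1 - a * b * c * d * q ^ (2 * j + 1) ≠ 0 := hP.one_sub_abcd_ne H (by omega)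
  have ih := hP.kNum_mul_eq H hq0 hR hci (show j + 1 < D by omega)
  rw [kNum_succ, pow_succ (a ^ 2) (j + 1),
    qPoch_succ q q (j + 1), qPoch_succ (b * c) q (j + 1), qPoch_succ (b * d) q (j + 1),
    qPoch_succ (a * b) q (j + 1), qPoch_succ (a * c) q (j + 1),
    qPoch_succ (a * d) q (j + 1), qPoch_succ (a * b * c * d) q j]
  rw [div_mul_eq_mul_div, div_eq_iff h2]
  apply mul_right_cancel₀ h3
  linear_combination
    (bi (j + 1) : ℂ) * (a ^ 2 * ((1 - q * q ^ (j + 1)) * (1 - b * c * q ^ (j + 1)) *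
      (1 - b * d * q ^ (j + 1)))) * (1 - a * b * c * d * q ^ (2 * j + 1)) * ih +
    (1 - a * b * c * d * q ^ (2 * j + 1)) * (qPoch (a * b * c * d) q j *
      (qPoch (a * b) q (j + 1) * qPoch (a * c) q (j + 1) * qPoch (a * d) q (j + 1))) * h1

end IsAskeyWilsonParam

end

/-! ### Normalising factors of the monic polynomials. -/

section

/-- The factor between `P_i` and `p_i`. -/
noncomputable def monicFactor (q a b c d : ℂ) (i : ℕ) : ℂ :=
  qPoch (a * b) q i * qPoch (a * c) q i * qPoch (a * d) q i /
    (a ^ i * qPoch (a * b * c * d * q ^ ((i : ℤ) - 1)) q i)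

theorem monicAW_eq (q a b c d : ℂ) (i : ℕ) :
    monicAW q a b c d i = C (monicFactor q a b c d i) * askeyWilson q a b c d i := rfl

variable {D : ℕ} {q h hs s ss r₁ r₂ a b c d : ℂ} {θ θs φ ϕ : ℕ → ℂ} {bi ci : ℕ → ℕ}

namespace IsAskeyWilsonParam

theorem monicFactor_succ (q a b c d : ℂ) (j : ℕ) :
    monicFactor q a b c d (j + 1) =
      qPoch (a * b) q (j + 1) * qPoch (a * c) q (j + 1) * qPoch (a * d) q (j + 1) /
        (a ^ (j + 1) * qPoch (a * b * c * d * q ^ j) q (j + 1)) := by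
  rw [monicFactor, show ((j + 1 : ℕ) : ℤ) - 1 = (j : ℤ) by push_cast; ring, zpow_natCast]

theorem qPoch_abcd_ne (hP : IsAskeyWilsonParam D q ss r₁ r₂ a b c d)
    (H : IsQRacah D q h hs s ss r₁ r₂ θ θs φ ϕ) {m n : ℕ} (hmn : m + n + 1 ≤ 2 * D) :
    qPoch (a * b * c * d * q ^ m) q n ≠ 0 := by
  refine qPoch_ne_zero fun j hj => ?_
  rw [mul_assoc, ← pow_add]
  exact hP.one_sub_abcd_ne H (by omega)

/-- Split `(abcd; q)_{2i}` as `(abcd; q)_{i-1} (abcd q^{i-1}; q)_i (1 - abcd q^{2i-1})`. The middle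
part cancels the denominator of the monic factor and the rest is `kNum_mul_eq`. -/
theorem mul_monicFactor (hP : IsAskeyWilsonParam D q ss r₁ r₂ a b c d)
    (H : IsQRacah D q h hs s ss r₁ r₂ θ θs φ ϕ) (hq0 : q ≠ 0)
    (hq : ∀ n : ℕ, 0 < n → q ^ n ≠ 1)
    (hR : HasRacahNumbers D q h ss r₁ r₂ bi ci) (hci : ∀ j < D, (ci (j + 1) : ℂ) ≠ 0) {j : ℕ}
    (hj : j + 1 < D) :
    qPoch (a * b * c * d) q (2 * (j + 1)) / (a ^ (j + 1) * (qPoch q q (j + 1) *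
        qPoch (b * c) q (j + 1) * qPoch (b * d) q (j + 1) * qPoch (c * d) q (j + 1))) *
      monicFactor q a b c d (j + 1) = kNum bi ci (j + 1) := by
  have h0 := hP.a_ne
  have h1 := hP.qPoch_abcd_ne H (m := j) (n := j + 1) (by omega)
  have h2 : qPoch q q (j + 1) ≠ 0 := qPoch_ne_zero fun i _ => one_sub_q_ne hq i
  have h3 : qPoch (b * c) q (j + 1) ≠ 0 :=
    qPoch_ne_zero fun i hi => hP.one_sub_bc_ne H (by omega)
  have h4 : qPoch (b * d) q (j + 1) ≠ 0 :=
    qPoch_ne_zero fun i hi => hP.one_sub_bd_ne H (by omega)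
  have h5 : qPoch (c * d) q (j + 1) ≠ 0 :=
    qPoch_ne_zero fun i hi => hP.one_sub_cd_ne H (by omega)
  have h6 := hP.kNum_mul_eq H hq0 hR hci hj
  rw [monicFactor_succ, show 2 * (j + 1) = (j + (j + 1)) + 1 by ring, qPoch_succ, qPoch_add,
    show j + (j + 1) = 2 * j + 1 by ring, div_mul_div_comm, div_eq_iff (by positivity)]
  linear_combination -qPoch (a * b * c * d * q ^ j) q (j + 1) * h6

theorem mul_monicFactor_last (hP : IsAskeyWilsonParam D q ss r₁ r₂ a b c d)
    (H : IsQRacah D q h hs s ss r₁ r₂ θ θs φ ϕ) (hq0 : q ≠ 0)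
    (hq : ∀ n : ℕ, 0 < n → q ^ n ≠ 1)
    (hR : HasRacahNumbers D q h ss r₁ r₂ bi ci) (hci : ∀ j < D, (ci (j + 1) : ℂ) ≠ 0)
    (hD : 2 ≤ D) :
    qPoch (a * b * c * d) q (2 * D - 1) / (a ^ D * (qPoch q q D *
        qPoch (b * c) q D * qPoch (b * d) q D) * qPoch (c * d) q (D - 1)) *
      monicFactor q a b c d D = kNum bi ci D := by
  obtain ⟨j, rfl⟩ : ∃ j, D = j + 2 := ⟨D - 2, by omega⟩
  have h0 := hP.a_ne
  have h1 := hP.qPoch_abcd_ne H (m := j + 1) (n := j + 2) (by omega)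
  have h2 : qPoch q q (j + 2) ≠ 0 := qPoch_ne_zero fun i _ => one_sub_q_ne hq i
  have h3 : qPoch (b * c) q (j + 2) ≠ 0 :=
    qPoch_ne_zero fun i hi => hP.one_sub_bc_ne H (by omega)
  have h4 : qPoch (b * d) q (j + 2) ≠ 0 :=
    qPoch_ne_zero fun i hi => hP.one_sub_bd_ne H (by omega)
  have h5 : qPoch (c * d) q (j + 1) ≠ 0 :=
    qPoch_ne_zero fun i hi => hP.one_sub_cd_ne H (by omega)
  have h6 := hP.kNum_last_mul_eq H hq0 hR hci rfl
  rw [monicFactor_succ, show 2 * (j + 2) - 1 = (j + 1) + (j + 2) by omega, qPoch_add,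
    show j + 2 - 1 = j + 1 from rfl, show j + 1 + 1 = j + 2 from rfl, div_mul_div_comm,
    div_eq_iff (by positivity)]
  linear_combination -qPoch (a * b * c * d * q ^ (j + 1)) q (j + 2) * h6

theorem xi_succ (hP : IsAskeyWilsonParam D q ss r₁ r₂ a b c d) (hq0 : q ≠ 0) (j : ℕ) :
    xi D q ss (j + 1) = (1 - a * b * q ^ (j + 1)) * (1 - a * b * c * d * q ^ j) / q ^ j := by
  have h1 : q ^ j ≠ 0 := pow_ne_zero j hq0
  rw [xi_eq hq0, hP.abcd, hP.ab, one_div_mul_eq_div, pow_succ]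
  field_simp

theorem eps_succ (hP : IsAskeyWilsonParam D q ss r₁ r₂ a b c d) (hq0 : q ≠ 0) (j : ℕ) :
    eps D q ss (j + 1) = a * b * (1 - q ^ (j + 1)) * (1 - c * d * q ^ j) /
      ((1 - a * b * q ^ (j + 1)) * (1 - a * b * c * d * q ^ j)) := by
  have h1 : q ^ D ≠ 0 := pow_ne_zero D hq0
  have h2 : q ^ D - q ^ (j + 1) = q ^ D * (1 - 1 / q ^ D * q ^ (j + 1)) := by field_simp
  rw [eps_eq hq0, hP.abcd, hP.cd, hP.ab, h2]
  have h3 : 1 - ss * (q ^ D * q ^ (j + 1) * q) = 1 - ss * (q ^ D * q ^ 2) * q ^ j := by ring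
  have h4 : 1 - ss * (q ^ (j + 1) * q) = 1 - ss * q ^ 2 * q ^ j := by ring
  rw [h3, h4, mul_assoc (q ^ D), ← div_div]
  congr 1
  rw [mul_assoc (1 / q ^ D), one_div_mul_eq_div]

theorem one_sub_eps_succ (hP : IsAskeyWilsonParam D q ss r₁ r₂ a b c d)
    (H : IsQRacah D q h hs s ss r₁ r₂ θ θs φ ϕ) (hq0 : q ≠ 0)
    (hq : ∀ n : ℕ, 0 < n → q ^ n ≠ 1) {j : ℕ} (hj : j + 1 < D) :
    1 - eps D q ss (j + 1) = (1 - a * b) * (1 - a * b * c * d * q ^ (2 * j + 1)) /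
      ((1 - a * b * q ^ (j + 1)) * (1 - a * b * c * d * q ^ j)) := by
  have h1 : 1 - a * b * q ^ (j + 1) ≠ 0 := hP.one_sub_ab_ne hq0 hq hj
  have h2 : 1 - a * b * c * d * q ^ j ≠ 0 := hP.one_sub_abcd_ne H (by omega)
  rw [hP.eps_succ hq0, eq_div_iff (mul_ne_zero h1 h2), sub_mul,
    div_mul_cancel₀ _ (mul_ne_zero h1 h2)]
  ring

/-- The relation between `P_{j+1}/p_{j+1}` and its counterpart for the parameters
`(aq, bq, c, d)`. -/
theorem monicFactor_perp (hP : IsAskeyWilsonParam D q ss r₁ r₂ a b c d)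
    (H : IsQRacah D q h hs s ss r₁ r₂ θ θs φ ϕ) (hq0 : q ≠ 0)
    (hq : ∀ n : ℕ, 0 < n → q ^ n ≠ 1)
    (hR : HasRacahNumbers D q h ss r₁ r₂ bi ci) (hci : ∀ j < D, (ci (j + 1) : ℂ) ≠ 0) {j : ℕ}
    (hj : j + 1 < D) :
    xi D q ss (j + 1) *
        (b * ((1 - ss * q ^ 2) * (1 - ss * q ^ 3) / ((1 - ss * q / r₁) * (1 - ss * q / r₂)))) *
        monicFactor q a b c d (j + 1) =
      xi D q ss 1 ^ 2 * (kNum bi ci 1 * eps D q ss 1) *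
        monicFactor q (a * q) (b * q) c d j := by
  have a0 := hP.a_ne
  have hqj : q ^ j ≠ 0 := pow_ne_zero j hq0
  have n1 := hP.one_sub_ab_ne hq0 hq hj
  have n2 : 1 - a * b * c * d * q ^ j ≠ 0 := hP.one_sub_abcd_ne H (by omega)
  have n3 := hP.one_sub_ab_ne hq0 hq (show 1 < D by omega)
  have n4 : 1 - a * b * c * d * q ^ 0 ≠ 0 := hP.one_sub_abcd_ne H (by omega)
  have n5 := hP.one_sub_bc_ne H (show 0 < D by omega)
  have n6 := hP.one_sub_bd_ne H (show 0 < D by omega)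
  have n7 := hP.one_sub_cd_ne H (show 0 + 2 ≤ D by omega)
  have n8 := one_sub_q_ne hq 0
  have hW := hP.qPoch_abcd_ne H (m := j + 1) (n := j) (by omega)
  have hk := hP.kNum_mul_eq H hq0 hR hci (show 0 + 1 < D by omega)
  have hperp : monicFactor q (a * q) (b * q) c d j =
      qPoch (a * b * q ^ 2) q j * qPoch (a * c * q) q j * qPoch (a * d * q) q j /
        (a ^ j * q ^ j * qPoch (a * b * c * d * q ^ (j + 1)) q j) := by
    have e1 : a * q * (b * q) = a * b * q ^ 2 := by ring
    have e2 : a * q * c = a * c * q := by ring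
    have e3 : a * q * d = a * d * q := by ring
    have e4 : a * b * q ^ 2 * c * d * q ^ ((j : ℤ) - 1) = a * b * c * d * q ^ (j + 1) := by
      rw [zpow_sub₀ hq0, zpow_natCast, zpow_one]
      field_simp
      ring
    rw [monicFactor, e1, e2, e3, e4, mul_pow]
  -- `(ab; q)_{j+1}` and the shifted `(abq²; q)_j` differ only by end factors, which `ξ_1`,
  -- `ξ_{j+1}` and `k_1` supply.
  have hab : qPoch (a * b) q (j + 1) * (1 - a * b * q ^ (j + 1)) =
      (1 - a * b) * ((1 - a * b * q) * qPoch (a * b * q ^ 2) q j) := by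
    rw [← qPoch_succ, qPoch_succ', qPoch_succ', pow_two, mul_assoc (a * b) q q]
  have e5 : ss * q / r₁ = b * c := hP.bc.symm
  have e6 : ss * q / r₂ = b * d := hP.bd.symm
  have e7 : ss * q ^ 2 = a * b * c * d := hP.abcd.symm
  have e8 : ss * q ^ 3 = a * b * c * d * q := by rw [hP.abcd]; ring
  rw [hperp, monicFactor_succ, hP.xi_succ hq0, hP.xi_succ hq0 0, hP.eps_succ hq0 0, e5, e6, e7,
    e8, qPoch_succ' (a * c), qPoch_succ' (a * d), qPoch_succ' (a * b * c * d * q ^ j),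
    mul_assoc (a * b * c * d) (q ^ j) q, ← pow_succ]
  generalize qPoch (a * b) q (j + 1) = A' at *
  simp only [Nat.zero_add, pow_one, pow_zero, mul_one, div_one, qPoch_succ, qPoch_zero, one_mul,
    Nat.mul_zero] at n3 n4 n5 n6 n7 n8 hk ⊢
  generalize qPoch (a * b * c * d * q ^ (j + 1)) q j = W at *
  generalize qPoch (a * b * q ^ 2) q j = A at *
  generalize qPoch (a * c * q) q j = B
  generalize qPoch (a * d * q) q j = B'
  generalize 1 - a * b * q ^ (j + 1) = Y at *
  generalize 1 - a * b * c * d * q ^ j = Z at *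
  -- The denominator of `k_1` contains `(1 - bc)(1 - bd)`, the denominator in the constant of `g`.
  -- After this substitution the identity is one between monomials in the named factors.
  have hk' : kNum bi ci 1 = (1 - a * b * c * d * q) * ((1 - a * b) * (1 - a * c) * (1 - a * d)) /
      (a ^ 2 * ((1 - q) * (1 - b * c) * (1 - b * d) * (1 - c * d))) := by
    rw [eq_div_iff (by positivity), hk]
  rw [hk', eq_div_of_mul_eq n1 hab, pow_succ a j]
  have haj : a ^ j ≠ 0 := pow_ne_zero j a0
  generalize a ^ j = aj at *
  generalize q ^ j = Q at *
  generalize 1 - a * b * c * d = V at *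
  generalize 1 - a * b * c * d * q = V' at *
  generalize 1 - b * c = m1 at *
  generalize 1 - b * d = m2 at *
  generalize 1 - c * d = m3 at *
  generalize 1 - q = m4 at *
  generalize 1 - a * b * q = m5 at *
  generalize 1 - a * b = m6 at *
  field_simp

end IsAskeyWilsonParam

end

end NonsymRacah

/-! ### The proposition: comparison of coefficients. -/

theorem proposition7p8 {X : Type*} [Fintype X] [DecidableEq X]
    -- a distance-regular graph of diameter `D ≥ 3`
    (G : SimpleGraph X) (D : ℕ) (hD : 3 ≤ D) (hdiam : G.diam = D)
    (ai bi ci : ℕ → ℕ) (hG : IsDistanceRegular G ai bi ci)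
    -- a `Q`-polynomial ordering of its primitive idempotents, whose last eigenvalue is the least
    (θ : ℕ → ℝ) (E : ℕ → Matrix X X ℂ) (hE : IsEigenOrdering G D θ E)
    (hQ : IsQPolynomial D E) (hmin : ∀ i ≤ D, θ D ≤ θ i)
    -- a Delsarte clique and a vertex in it
    (K : Finset X) (hK : IsDelsarteClique G (bi 0) K) (x : X) (hx : x ∈ K)
    -- the parameter array, of `q`-Racah type
    (θs φ ϕ : ℕ → ℂ) (hθs : IsDualEigenvalues G E x θs)
    (hpar : IsParameterArray (distMatrix G 1) (dualAdj E x) (primaryModule G x) D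
      (fun i => (θ i : ℂ)) θs φ ϕ)
    (q h hs s ss r₁ r₂ : ℂ) (hq0 : q ≠ 0) (hq : ∀ n : ℕ, 0 < n → q ^ n ≠ 1)
    (hrac : IsQRacah D q h hs s ss r₁ r₂ (fun i => (θ i : ℂ)) θs φ ϕ)
    -- square roots of `q, s, s*, r₁, r₂`
    (q' s' ss' r₁' r₂' : ℂ) (hq' : q' ^ 2 = q) (hs' : s' ^ 2 = s) (hss' : ss' ^ 2 = ss)
    (hr₁' : r₁' ^ 2 = r₁) (hr₂' : r₂' ^ 2 = r₂) (hr' : r₁' * r₂' = s' * ss' * q' ^ (D + 1))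
    -- the associated Askey-Wilson parameters
    (a b c d : ℂ) (ha : a = r₁' * r₂' / (ss' * q' ^ D)) (hb : b = ss' / (r₁' * r₂' * q' ^ D))
    (hc : c = r₂' * ss' * q' ^ (D + 2) / r₁') (hd : d = r₁' * ss' * q' ^ (D + 2) / r₂')
    (εp εm : ℕ → LaurentPolynomial ℂ)
    (hεp : εp = epsPlus D q ss r₁ r₂ a b c d (kNum bi ci) (kPerp G x K D q ss))
    (hεm : εm = epsMinus D q ss r₁ r₂ a b c d (kNum bi ci) (kPerp G x K D q ss)) :
    (∀ i, 1 ≤ i → i ≤ D - 1 →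
      εp (i - 1) =
        C (a * b * (1 - q ^ i) * (1 - c * d * q ^ (i - 1)) /
            ((a * b - 1) * (1 - a * b * c * d * q ^ (2 * i - 1))) *
          (qPoch (a * b * c * d) q (2 * i) /
            (a ^ i * (qPoch q q i * qPoch (b * c) q i * qPoch (b * d) q i *
              qPoch (c * d) q i)))) *
        (monicAW q a b c d i -
          T 1 * (1 - C a * T (-1)) * (1 - C b * T (-1)) *
            monicAW q (a * q) (b * q) c d (i - 1)) ∧
      εm i =
        C ((1 - a * b * q ^ i) * (1 - a * b * c * d * q ^ (i - 1)) /
            ((1 - a * b) * (1 - a * b * c * d * q ^ (2 * i - 1))) *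
          (qPoch (a * b * c * d) q (2 * i) /
            (a ^ i * (qPoch q q i * qPoch (b * c) q i * qPoch (b * d) q i *
              qPoch (c * d) q i)))) *
        (monicAW q a b c d i -
          C (a * b * (1 - q ^ i) * (1 - c * d * q ^ (i - 1)) /
              ((1 - a * b * q ^ i) * (1 - a * b * c * d * q ^ (i - 1)))) *
            (T 1 * (1 - C a * T (-1)) * (1 - C b * T (-1)) *
              monicAW q (a * q) (b * q) c d (i - 1)))) ∧
    εm 0 = 1 ∧
    εp (D - 1) =
      C (qPoch (a * b * c * d) q (2 * D - 1) /
          (a ^ D * (qPoch q q D * qPoch (b * c) q D * qPoch (b * d) q D) *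
            qPoch (c * d) q (D - 1))) *
        monicAW q a b c d D := by
  subst hdiam hεp hεm
  have hP := isAskeyWilsonParam_of_sqrt (D := G.diam) hq0 hrac.ss_ne hrac.r₁_ne hrac.r₂_ne hq' hss'
    hr₁' hr₂' ha hb hc hd
  obtain ⟨hR, γ, hγ0, hγr, hγ⟩ := hasRacahNumbers hD rfl hG hE hQ hθs hpar hq0 hq hrac
  have hkp := fun j (hj : j + 1 < G.diam) =>
    kPerp_eq_kNum hD rfl hG hE hmin hK hx hq0 hq hrac hR hγ0 hγr hγ hj
  have hci : ∀ j < G.diam, (ci (j + 1) : ℂ) ≠ 0 := fun j hj => by exact_mod_cast hG.c_ne_zero hj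
  have hk : ∀ j ≤ G.diam, kNum bi ci j ≠ 0 := fun j hj => hG.kNum_ne_zero hj
  generalize G.diam = D at *
  generalize kPerp G x K D q ss = kp at *
  -- Here `ab = q^{-D}` makes the bracket of `g` factor.
  have hg : gPoly D q ss r₁ r₂ a b =
      C (b * ((1 - ss * q ^ 2) * (1 - ss * q ^ 3) / ((1 - ss * q / r₁) * (1 - ss * q / r₂)))) *
        (T 1 * (1 - C a * T (-1)) * (1 - C b * T (-1))) := by
    have h1 : (T 1 : LaurentPolynomial ℂ) * T (-1) = 1 := by
      rw [← T_add, add_neg_cancel, T_zero]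
    rw [gPoly, ← hP.ab, C.map_mul a b]
    linear_combination (C (b * ((1 - ss * q ^ 2) * (1 - ss * q ^ 3) /
      ((1 - ss * q / r₁) * (1 - ss * q / r₂))))) * (C a + C b - C a * C b * T (-1)) * h1
  refine ⟨?_, ?_, ?_⟩
  · intro i hi1 hi2
    obtain ⟨j, rfl⟩ : ∃ j, i = j + 1 := ⟨i - 1, by omega⟩
    have hj : j + 1 < D := by omega
    have hkj := hkp j hj
    have hmf := hP.mul_monicFactor hrac hq0 hq hR hci hj
    have hperp := hP.monicFactor_perp hrac hq0 hq hR hci hj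
    have he := hP.eps_succ hq0 j
    have h1e := hP.one_sub_eps_succ hrac hq0 hq hj
    have h1e0 := hrac.one_sub_eps_ne_zero hq0 hq hj
    have hxi0 := hrac.xi_ne_zero hq0 hq (show 1 ≤ j + 1 by omega) hj
    have hxi1 := hrac.xi_ne_zero hq0 hq le_rfl (show 1 < D by omega)
    have he1 := hrac.eps_ne_zero hq0 hq le_rfl (show 1 < D by omega)
    have hk1 := hk 1 (by omega)
    have n1 := hP.one_sub_ab_ne hq0 hq hj
    have n2 : 1 - a * b * c * d * q ^ j ≠ 0 := hP.one_sub_abcd_ne hrac (by omega)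
    have n3 : 1 - a * b ≠ 0 := by
      have := hP.one_sub_ab_ne hq0 hq (show 0 < D by omega)
      rwa [pow_zero, mul_one] at this
    simp only [Nat.add_sub_cancel, monicAW_eq, hg, epsPlus, epsMinus]
    rw [if_neg (by omega), if_neg (by omega), show 2 * (j + 1) - 1 = 2 * j + 1 by omega]
    -- From here on the polynomials are arbitrary ring elements and only scalar coefficients are
    -- compared.
    generalize askeyWilson q a b c d (j + 1) = p
    generalize askeyWilson q (a * q) (b * q) c d j = p'
    generalize T 1 * (1 - C a * T (-1)) * (1 - C b * T (-1)) = Y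
    generalize (b * ((1 - ss * q ^ 2) * (1 - ss * q ^ 3) /
      ((1 - ss * q / r₁) * (1 - ss * q / r₂)))) = g at *
    generalize qPoch (a * b * c * d) q (2 * (j + 1)) / (a ^ (j + 1) * (qPoch q q (j + 1) *
      qPoch (b * c) q (j + 1) * qPoch (b * d) q (j + 1) * qPoch (c * d) q (j + 1))) = M at *
    generalize monicFactor q a b c d (j + 1) = F at *
    generalize monicFactor q (a * q) (b * q) c d j = F' at *
    have hneg : eps D q ss (j + 1) - 1 ≠ 0 := by
      rw [← neg_sub]
      exact neg_ne_zero.2 h1e0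
    have hc1 : a * b * (1 - q ^ (j + 1)) * (1 - c * d * q ^ j) /
        ((a * b - 1) * (1 - a * b * c * d * q ^ (2 * j + 1))) =
        eps D q ss (j + 1) / (eps D q ss (j + 1) - 1) := by
      have n5 : a * b - 1 ≠ 0 := by
        rw [← neg_sub]
        exact neg_ne_zero.2 n3
      have h2 : eps D q ss (j + 1) - 1 = (a * b - 1) * (1 - a * b * c * d * q ^ (2 * j + 1)) /
          ((1 - a * b * q ^ (j + 1)) * (1 - a * b * c * d * q ^ j)) := by
        rw [← neg_sub, h1e, ← neg_div]
        congr 1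
        ring
      rw [h2, he, div_div_div_cancel_right₀ (mul_ne_zero n1 n2)]
    have hc3 : (1 - a * b * q ^ (j + 1)) * (1 - a * b * c * d * q ^ j) /
        ((1 - a * b) * (1 - a * b * c * d * q ^ (2 * j + 1))) =
        1 / (1 - eps D q ss (j + 1)) := by
      rw [h1e, one_div_div]
    rw [hc1, hc3, ← he]
    have hperp' : 1 / xi D q ss (j + 1) * kp j * g * F =
        kNum bi ci (j + 1) * eps D q ss (j + 1) * F' := by
      rw [hkj]
      field_simp
      linear_combination kNum bi ci (j + 1) * eps D q ss (j + 1) * hperp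
    -- `F` divides `k_{j+1} ≠ 0`, so it can be cancelled from `hperp'` to isolate the coefficient of
    -- `Y p^⊥`.
    have hF : F ≠ 0 := by
      rintro rfl
      rw [mul_zero] at hmf
      exact hk (j + 1) (by omega) hmf.symm
    have hkg : 1 / xi D q ss (j + 1) * kp j * g = eps D q ss (j + 1) * M * F' := by
      apply mul_right_cancel₀ hF
      rw [hperp', ← hmf]
      ring
    -- Here `κ` is the outer constant of the claimed formula and `μ` the coefficient of its second
    -- term: `1` for `ε⁺` and `ϵ_{j+1}` for `ε⁻`.
    have combine : ∀ α β κ μ : ℂ, α = κ * F → β * g = -(κ * μ * F') →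
        C α * p + C β * p' * (C g * Y) = C κ * (C F * p - C μ * (Y * (C F' * p'))) := by
      intro α β κ μ h1 h2
      have h3 : (C α : LaurentPolynomial ℂ) = C κ * C F := by rw [h1, C.map_mul]
      have h4 : (C β : LaurentPolynomial ℂ) * C g = -(C κ * C μ * C F') := by
        have h5 := congrArg C (eq_neg_iff_add_eq_zero.1 h2)
        rw [C.map_add, C.map_mul, C.map_mul, C.map_mul, C.map_zero] at h5
        exact eq_neg_of_add_eq_zero_left h5
      linear_combination p * h3 + p' * Y * h4
    constructor
    · have h := combine (eps D q ss (j + 1) / (eps D q ss (j + 1) - 1) * kNum bi ci (j + 1))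
        (1 / (xi D q ss (j + 1) * (1 - eps D q ss (j + 1))) * kp j)
        (eps D q ss (j + 1) / (eps D q ss (j + 1) - 1) * M) 1 (by rw [← hmf]; ring) (by
          rw [← one_div_mul_one_div, mul_right_comm (1 / xi D q ss (j + 1)), mul_right_comm, hkg,
            ← neg_sub (eps D q ss (j + 1)) 1]
          field_simp)
      rw [h, C.map_one, one_mul]
    · refine combine _ _ _ _ (by rw [← hmf]; ring) ?_
      rw [← one_div_mul_one_div, mul_right_comm (1 / xi D q ss (j + 1)), mul_right_comm, hkg,
        ← neg_sub 1 (eps D q ss (j + 1))]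
      field_simp
  · simp [epsMinus]
  · have h1 := hP.mul_monicFactor_last hrac hq0 hq hR hci (by omega)
    rw [epsPlus, if_pos (by omega), monicAW_eq, ← h1, C.map_mul, mul_assoc]
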